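/- Theorem (The fourth Birkhoff polytope $B_4$ has a non-regular triangulation). Conventions. A triangulation of a finite set $A$ of points in convex position is a (geometric) simplicial complex with vertices in $A$ whose union is $\operatorname{conv}(A)$. It is regular if, for some lifting $w:A\to\mathbb{R}$, its simplices are exactly the projections of the faces of the lower envelope of $\operatorname{conv}\{(a,w(a)) : a\in A\}$, i.e. of the non-empty faces that have an outward normal vector with negative last coordinate. A triangulation of a polytope means a triangulation of its vertex set. A simplex $\sigma$ of a triangulation $\mathcal S$ is visible from a point $p$ if there are a linear functional $f$ and $c\in\mathbb R$ with $f\ge c$ on all vertices of $\mathcal S$, $f=c$ on $\sigma$ and $f(p)<c$. Placing $p$ adds to $\mathcal S$ the point $p$ and all joins of $p$ with simplices visible from $p$. Pulling $p$ subdivides each face containing $p$ into the cones with apex $p$ over its faces that do not contain $p$. Let $B_4$ be the polytope of doubly stochastic $4\times 4$ matrices and let $F=\{x\in B_4 : x_{11}=x_{44}=0\}$. Write a permutation matrix as the word $\pi(1)\pi(2)\pi(3)\pi(4)$ if its entries equal to $1$ are those at $(i,\pi(i))$, and let $X_a,\dots,X_n$ be, in this order, $$2431,\ 2341,\ 2413,\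 2143,\ 3421,\ 3412,\ 3241,\ 3142,\ 4321,\ 4312,\ 4213,\ 4231,\ 4123,\ 4132 .$$ Let $\sigma_1,\dots,\sigma_{32}$ be the convex hulls of the sets of eight points $X_z$ with labels $z$, in this order, $abcdefgi$, $abdefghi$, $acdefgik$, $adefghik$, $aefghikl$, $adeghikl$, $afghijkl$, $acdefikm$, $adefhikm$, $acdfijkm$, $adfhijkm$, $aefhiklm$, $deghiklm$, $adehiklm$, $acdfjkmn$, $adfhjkmn$, $aefhilmn$, $afhiklmn$, $adhiklmn$, $afhijkmn$, $adhijkmn$, $afhijkln$, $abcdfijk$, $abcdfgik$, $abfghijk$, $abghijkl$, $abdfhijk$, $abdfghik$, $abdghikl$, $abhijkln$, $abdhikln$, $abdhijkn$, and let $\mathcal T$ consist of these simplices and all their faces. Let $Y_a,\dots,Y_n\in\mathbb{R}^6$ be the columns, in this order, of $$\left[\begin{array}{rrrrrrrrrrrrrr} 0&0&1&-1&0&-1&0&1&0&0&0&0&0&0\\ 0&0&0&0&1&-1&0&0&-1&1&0&0&0&0\\ 0&1&-1&0&1&0&-1&0&-1&0&1&0&0&0\\ -1&1&0&0&1&0&-1&0&-1&0&0&1&0&0\\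 0&1&0&-1&0&0&0&0&-1&0&0&0&1&0\\ -1&1&1&-1&1&-1&0&0&-1&0&0&0&0&1 \end{array}\right],$$ and let $C_i$ be the cone generated by the vectors $Y_z$ for which $z$ is not a label of $\sigma_i$. Then: 1. $F$ is a $7$-dimensional face of $B_4$, and its vertices are the $14$ distinct points $X_a,\dots,X_n$. 2. The $32$ label sets are distinct, and $\mathcal T$ is a triangulation of $F$ (so that $\sigma_1,\dots,\sigma_{32}$ are its $7$-dimensional simplices). 3. $Y_a,\dots,Y_n$ is a Gale transform of the vector configuration $(1,X_a),\dots,(1,X_n)$ in $\mathbb{R}^{17}$: the rows of the matrix above are a basis of the space of linear dependences of these vectors. Each $C_i$ is a simple, full-dimensional cone in $\mathbb{R}^6$. 4. The inequalities $y_3\ge 0$, $\ -y_2-y_5+y_6\ge 0$, $\ -y_4+y_5\ge 0$ and $\ y_2-y_3+y_4-y_6\ge 0$ are facet-defining for $C_1$, $C_{10}$, $C_{13}$ and $C_{32}$, respectively. No $y\in\mathbb{R}^6$ satisfies all four strictly, and $\bigcap_{i=1}^{32}\operatorname{relint}(C_i)=\emptyset$. 5. The triangulation $\mathcal T$ of $F$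 is not regular. 6. For every ordering of the vertices of $B_4$ that are not in $F$: placing these vertices one after the other, starting from $\mathcal T$, yields a triangulation of $B_4$; so does pulling them one after the other, starting from $B_4$, and then subdividing the remaining faces, which are contained in $F$, by $\mathcal T$. Each of these triangulations has $\mathcal T$ as its set of simplices contained in $F$, and none is regular. In particular, $B_4$ has a non-regular triangulation extending $\mathcal T$. -/

import Mathlib

namespace BirkhoffFour

/-! ### Triangulations and regularity -/

section Triangulations

variable {E : Type*} [AddCommGroup E] [Module ℝ E]

/-- A triangulation of a finite point configuration `A` (in convex position): a set `T` of
simplices, each given by its nonempty vertex set, which is the set of all faces of a geometric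
simplicial complex with vertices in `A` and with underlying space `conv A`. -/
def IsTriangulation (A : Set E) (T : Set (Finset E)) : Prop :=
  A.Finite ∧ ∃ K : Geometry.SimplicialComplex ℝ E,
    K.faces = T ∧ K.vertices ⊆ A ∧ K.space = convexHull ℝ A

/-- The lifted polytope `conv {(a, w a) | a ∈ A}` of a lifting `w`. -/
def liftedPolytope (A : Set E) (w : E → ℝ) : Set (E × ℝ) :=
  convexHull ℝ ((fun a => (a, w a)) '' A)

/-- The faces of the lower envelope of the lifting `w`, that is, the nonempty faces of the lifted
polytope that have an outward normal with negative last coordinate. After scaling, the outward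
normal is `(-φ, -1)`, and the face is where `(x, t) ↦ φ x + t` is minimal. -/
def lowerFaces (A : Set E) (w : E → ℝ) : Set (Set (E × ℝ)) :=
  {G | G.Nonempty ∧ ∃ φ : E →ₗ[ℝ] ℝ,
    G = {z ∈ liftedPolytope A w | ∀ z' ∈ liftedPolytope A w, φ z.1 + z.2 ≤ φ z'.1 + z'.2}}

/-- A triangulation `T` of `A` is regular if, for some lifting `w`, its simplices are exactly the
projections of the faces of the lower envelope. -/
def IsRegularTriangulation (A : Set E) (T : Set (Finset E)) : Prop :=
  ∃ w : E → ℝ,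
    {S : Set E | ∃ τ ∈ T, S = convexHull ℝ (τ : Set E)} =
      (fun G => Prod.fst '' G) '' lowerFaces A w

/-! ### Placing and pulling -/

/-- The simplex with vertex set `τ` is visible from `p`, with respect to the convex hull of all
vertices of `T`: it lies in a supporting hyperplane that has `p` strictly on its other side. -/
def IsVisible (T : Set (Finset E)) (p : E) (τ : Finset E) : Prop :=
  ∃ (f : E →ₗ[ℝ] ℝ) (c : ℝ),
    (∀ ρ ∈ T, ∀ a ∈ ρ, c ≤ f a) ∧ (∀ b ∈ τ, f b = c) ∧ f p < c

/-- Placing the point `p`: add the point `p` and join it to all simplices visible from it. -/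
def place (T : Set (Finset E)) (p : E) : Set (Finset E) :=
  T ∪ {τ | (τ : Set E) = {p}} ∪
    {τ | ∃ ρ ∈ T, IsVisible T p ρ ∧ (τ : Set E) = insert p (ρ : Set E)}

/-- Placing the points of a list one after the other, starting from `T`. -/
def placing (T : Set (Finset E)) (l : List E) : Set (Finset E) :=
  l.foldl place T

/-- Pulling the points of a list in the polytope `P`, one after the other. Pulling `p` subdivides
every face that contains `p` into the cones with apex `p` over its faces that do not contain `p`.
When the list is exhausted, the remaining faces carry the simplices of `T`. -/
def pulling [TopologicalSpace E] (T : Set (Finset E)) : List E → Set E → Set (Finset E)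
  | [], P => {τ ∈ T | (τ : Set E) ⊆ P}
  | p :: l, P =>
    {τ | p ∉ P ∧ τ ∈ pulling T l P} ∪
    {τ | p ∈ P ∧ ((τ : Set E) = {p} ∨
      ∃ G : Set E, IsExposed ℝ P G ∧ p ∉ G ∧
        (τ ∈ pulling T l G ∨ ∃ ρ ∈ pulling T l G, (τ : Set E) = insert p (ρ : Set E)))}

end Triangulations

/-! ### Gale transforms and cones -/

/-- The vectors `B z` are a Gale transform of the vectors `A z`: the row space of the matrix with
columns `B z` is the orthogonal complement of the row space of the matrix with columns `A z`, and
the rows of the former are linearly independent. -/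
def IsGaleTransform {ι R S : Type*} [Fintype ι] (A : ι → R → ℝ) (B : ι → S → ℝ) : Prop :=
  LinearIndependent ℝ (fun (s : S) (z : ι) => B z s) ∧
  (Submodule.span ℝ (Set.range fun (s : S) (z : ι) => B z s) : Set (ι → ℝ)) =
    {c | ∀ r, ∑ z, c z * A z r = 0}

/-- `f ⬝ᵥ y ≥ 0` is a facet-defining inequality of the cone `C`: it is valid on `C`, and it is
tight on a face of codimension one. -/
def IsFacetInequality {S : Type*} [Fintype S] (C : Set (S → ℝ)) (f : S → ℝ) : Prop :=
  (∀ y ∈ C, 0 ≤ f ⬝ᵥ y) ∧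
  Module.finrank ℝ (Submodule.span ℝ {y ∈ C | f ⬝ᵥ y = 0}) + 1 =
    Module.finrank ℝ (Submodule.span ℝ C)

/-! ### The Birkhoff polytope, its face, and the explicit data -/

/-- The fourth Birkhoff polytope: the doubly stochastic `4 × 4` matrices. -/
def B₄ : Set (Matrix (Fin 4) (Fin 4) ℝ) := doublyStochastic ℝ (Fin 4)

/-- The part of the fourth Birkhoff polytope where the first and the last diagonal entries
vanish. -/
def F : Set (Matrix (Fin 4) (Fin 4) ℝ) := {M ∈ B₄ | M 0 0 = 0 ∧ M 3 3 = 0}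

/-- The fourteen labels. -/
inductive Label
  | a | b | c | d | e | f | g | h | i | j | k | l | m | n
  deriving DecidableEq

instance : Fintype Label where
  elems := {.a, .b, .c, .d, .e, .f, .g, .h, .i, .j, .k, .l, .m, .n}
  complete := by intro z; cases z <;> decide

/-- The fourteen points `X_a, …, X_n`. -/
def X : Label → Matrix (Fin 4) (Fin 4) ℝ
  | .a => !![0, 1, 0, 0; 0, 0, 0, 1; 0, 0, 1, 0; 1, 0, 0, 0]
  | .b => !![0, 1, 0, 0; 0, 0, 1, 0; 0, 0, 0, 1; 1, 0, 0, 0]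
  | .c => !![0, 1, 0, 0; 0, 0, 0, 1; 1, 0, 0, 0; 0, 0, 1, 0]
  | .d => !![0, 1, 0, 0; 1, 0, 0, 0; 0, 0, 0, 1; 0, 0, 1, 0]
  | .e => !![0, 0, 1, 0; 0, 0, 0, 1; 0, 1, 0, 0; 1, 0, 0, 0]
  | .f => !![0, 0, 1, 0; 0, 0, 0, 1; 1, 0, 0, 0; 0, 1, 0, 0]
  | .g => !![0, 0, 1, 0; 0, 1, 0, 0; 0, 0, 0, 1; 1, 0, 0, 0]
  | .h => !![0, 0, 1, 0; 1, 0, 0, 0; 0, 0, 0, 1; 0, 1, 0, 0]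
  | .i => !![0, 0, 0, 1; 0, 0, 1, 0; 0, 1, 0, 0; 1, 0, 0, 0]
  | .j => !![0, 0, 0, 1; 0, 0, 1, 0; 1, 0, 0, 0; 0, 1, 0, 0]
  | .k => !![0, 0, 0, 1; 0, 1, 0, 0; 1, 0, 0, 0; 0, 0, 1, 0]
  | .l => !![0, 0, 0, 1; 0, 1, 0, 0; 0, 0, 1, 0; 1, 0, 0, 0]
  | .m => !![0, 0, 0, 1; 1, 0, 0, 0; 0, 1, 0, 0; 0, 0, 1, 0]
  | .n => !![0, 0, 0, 1; 1, 0, 0, 0; 0, 0, 1, 0; 0, 1, 0, 0]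

/-- The label sets of the 32 simplices `σ_1, …, σ_32`, in this order (`σ_i` has index `i - 1`). -/
def simplex : Fin 32 → Finset Label :=
  ![
    {.a, .b, .c, .d, .e, .f, .g, .i},  {.a, .b, .d, .e, .f, .g, .h, .i},
    {.a, .c, .d, .e, .f, .g, .i, .k},  {.a, .d, .e, .f, .g, .h, .i, .k},
    {.a, .e, .f, .g, .h, .i, .k, .l},  {.a, .d, .e, .g, .h, .i, .k, .l},
    {.a, .f, .g, .h, .i, .j, .k, .l},  {.a, .c, .d, .e, .f, .i, .k, .m},
    {.a, .d, .e, .f, .h, .i, .k, .m},  {.a, .c, .d, .f, .i, .j, .k, .m},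
    {.a, .d, .f, .h, .i, .j, .k, .m},  {.a, .e, .f, .h, .i, .k, .l, .m},
    {.d, .e, .g, .h, .i, .k, .l, .m},  {.a, .d, .e, .h, .i, .k, .l, .m},
    {.a, .c, .d, .f, .j, .k, .m, .n},  {.a, .d, .f, .h, .j, .k, .m, .n},
    {.a, .e, .f, .h, .i, .l, .m, .n},  {.a, .f, .h, .i, .k, .l, .m, .n},
    {.a, .d, .h, .i, .k, .l, .m, .n},  {.a, .f, .h, .i, .j, .k, .m, .n},
    {.a, .d, .h, .i, .j, .k, .m, .n},  {.a, .f, .h, .i, .j, .k, .l, .n},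
    {.a, .b, .c, .d, .f, .i, .j, .k},  {.a, .b, .c, .d, .f, .g, .i, .k},
    {.a, .b, .f, .g, .h, .i, .j, .k},  {.a, .b, .g, .h, .i, .j, .k, .l},
    {.a, .b, .d, .f, .h, .i, .j, .k},  {.a, .b, .d, .f, .g, .h, .i, .k},
    {.a, .b, .d, .g, .h, .i, .k, .l},  {.a, .b, .h, .i, .j, .k, .l, .n},
    {.a, .b, .d, .h, .i, .k, .l, .n},  {.a, .b, .d, .h, .i, .j, .k, .n}]

/-- The simplices `σ_1, …, σ_32` on the points `X_a, …, X_n`, together with all their (nonempty)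
faces. -/
def T : Set (Finset (Matrix (Fin 4) (Fin 4) ℝ)) :=
  {τ | τ.Nonempty ∧ ∃ i, (τ : Set (Matrix (Fin 4) (Fin 4) ℝ)) ⊆ X '' (simplex i : Set Label)}

/-- The homogenization of the points `X_z`: the vectors with first coordinate `1` (here the one
with index `none`), followed by the 16 entries of `X_z`. -/
def homogenization (z : Label) : Option (Fin 4 × Fin 4) → ℝ
  | none => 1
  | some (i, j) => X z i j

/-- The vectors `Y_a, …, Y_n` of the Gale dual. -/
def Y : Label → Fin 6 → ℝ
  | .a => ![0, 0, 0, -1, 0, -1]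
  | .b => ![0, 0, 1, 1, 1, 1]
  | .c => ![1, 0, -1, 0, 0, 1]
  | .d => ![-1, 0, 0, 0, -1, -1]
  | .e => ![0, 1, 1, 1, 0, 1]
  | .f => ![-1, -1, 0, 0, 0, -1]
  | .g => ![0, 0, -1, -1, 0, 0]
  | .h => ![1, 0, 0, 0, 0, 0]
  | .i => ![0, -1, -1, -1, -1, -1]
  | .j => ![0, 1, 0, 0, 0, 0]
  | .k => ![0, 0, 1, 0, 0, 0]
  | .l => ![0, 0, 0, 1, 0, 0]
  | .m => ![0, 0, 0, 0, 1, 0]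
  | .n => ![0, 0, 0, 0, 0, 1]

/-- The complementary cones `C_1, …, C_32` (`C_i` has index `i - 1`): the cone `C_i` is generated
by the vectors `Y_z` with `z` not a label of `σ_i`. -/
def cone (i : Fin 32) : Set (Fin 6 → ℝ) :=
  PointedCone.hull ℝ (Y '' {z | z ∉ simplex i})

end BirkhoffFour

open BirkhoffFour

/-!
The fourth Birkhoff polytope has a non-regular triangulation.

*Triangulations as coordinates.* A down-closed set `T` of finite point sets is a triangulation of a
polytope `P` exactly when every point of `P` is a convex combination, with support in `T`, in
exactly one way (`IsRep`, `Triangulates`, `Triangulates.isTriangulation`). All statements about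
triangulations are proved in this form.

*Placing and pulling.* In both constructions a point `x` is written as `t • p + (1 - t) • y`, where
`p` is the new vertex and `y` lies in a simplex that exists already. For placing, `y` is the first
point of the polytope on the ray from `p` through `x`; for pulling, it is the last one. By Farkas'
lemma there is a supporting hyperplane at `y` that separates the polytope from the part of the ray
outside it (`exists_supporting`), so `y` has a carrier that is visible from `p`, or lies on a face
that does not contain `p`. Two such representations of `x` have the same `t`, and then the same
`y`. Uniqueness for pulling is shown across different faces at once (`pulling_unique`), which makes
the compatibility of the triangulations of the faces automatic.

*The triangulation of the face.* Affine dependences of the fourteen vertices of `F` are the vectors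
`gale y`. The hyperplanes spanned by the interior facets of the 32 simplices are the zero sets of 29
affine functions, the walls. Up to sign, each barycentric coordinate of each simplex is a wall
function or a matrix entry (`exists_coordinate`). A decision tree on the signs of the wall functions
shows that the simplices cover `F` (`exists_inChamber`). For any two simplices, every vertex outside
the common face lies off a wall that weakly separates them (`exists_separating_wall`), so the
simplices meet in that face only (`coeff_unique`).

*Non-regularity.* A lifting `w` that induces the simplex `i` can be changed by an affine function so
that it vanishes on the vertices of the simplex and is positive at all other vertices. Hence
`∑ z, w (X z) • Y z`, which does not depend on the affine function, is in the interior of the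
complementary cone `i` (`IsFacetNormal.dotProduct_lifting_pos`). The normals of four facets of four
of the cones add up to zero, so no lifting induces these four simplices. Since only the simplices
in `F` are used, the same argument excludes every triangulation that contains `T`.
-/

namespace BirkhoffFour

/-! ### Supporting hyperplanes of polytopes -/

section Polytopes

variable {E : Type*} [AddCommGroup E] [Module ℝ E]

/-- Farkas' lemma, in any real vector space. The induction step projects along the new vector
onto the kernel of a functional that separates `b` from the other vectors. -/
theorem farkas {ι : Type*} (s : Finset ι) (v : ι → E) (b : E) :
    (∃ c : ι → ℝ, (∀ i ∈ s, 0 ≤ c i) ∧ b = ∑ i ∈ s, c i • v i) ∨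
      ∃ f : E →ₗ[ℝ] ℝ, (∀ i ∈ s, 0 ≤ f (v i)) ∧ f b < 0 := by
  classical
  induction s using Finset.induction_on generalizing v b with
  | empty =>
    by_cases hb : b = 0
    · exact Or.inl ⟨0, by simp [hb]⟩
    · obtain ⟨f, hf⟩ : ∃ f : E →ₗ[ℝ] ℝ, f b ≠ 0 := by
        by_contra! h
        exact hb ((Module.forall_dual_apply_eq_zero_iff ℝ b).1 h)
      refine Or.inr ?_
      rcases lt_or_gt_of_ne hf with h | h
      · exact ⟨f, by simp, h⟩
      · exact ⟨-f, by simp, by simpa using h⟩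
  | insert j s hj ih =>
    rcases ih v b with ⟨c, hc, rfl⟩ | ⟨f, hf, hfb⟩
    · refine Or.inl ⟨Function.update c j 0, fun i hi => ?_, ?_⟩
      · rcases eq_or_ne i j with rfl | h
        · simp
        · simpa [h] using hc i ((Finset.mem_insert.1 hi).resolve_left h)
      · rw [Finset.sum_insert hj]
        simp only [Function.update_self, zero_smul, zero_add]
        refine Finset.sum_congr rfl fun i hi => ?_
        rw [Function.update_of_ne (ne_of_mem_of_not_mem hi hj)]
    · by_cases hfj : 0 ≤ f (v j)
      · refine Or.inr ⟨f, fun i hi => ?_, hfb⟩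
        rcases Finset.mem_insert.1 hi with rfl | hi
        exacts [hfj, hf i hi]
      push Not at hfj
      let π : E →ₗ[ℝ] E := LinearMap.id - ((f (v j))⁻¹ • f).smulRight (v j)
      have hπ : ∀ x, π x = x - ((f (v j))⁻¹ * f x) • v j := fun x => by simp [π]
      rcases ih (fun i => π (v i)) (π b) with ⟨c, hc, hb⟩ | ⟨g, hg, hgb⟩
      · refine Or.inl ⟨Function.update c j
          ((f (v j))⁻¹ * f b + ∑ i ∈ s, c i * (-(f (v j))⁻¹ * f (v i))), fun i hi => ?_, ?_⟩
        · have hinv : (f (v j))⁻¹ ≤ 0 := (inv_lt_zero.2 hfj).le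
          rcases eq_or_ne i j with rfl | h
          · rw [Function.update_self]
            exact add_nonneg (mul_nonneg_of_nonpos_of_nonpos hinv hfb.le)
              (Finset.sum_nonneg fun k hk => mul_nonneg (hc k hk)
                (mul_nonneg (neg_nonneg.2 hinv) (hf k hk)))
          · simpa [h] using hc i ((Finset.mem_insert.1 hi).resolve_left h)
        · rw [Finset.sum_insert hj, Function.update_self]
          have h1 : ∑ i ∈ s, Function.update c j ((f (v j))⁻¹ * f b +
              ∑ i ∈ s, c i * (-(f (v j))⁻¹ * f (v i))) i • v i = ∑ i ∈ s, c i • v i :=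
            Finset.sum_congr rfl fun i hi => by
              rw [Function.update_of_ne (ne_of_mem_of_not_mem hi hj)]
          have h2 : b = ((f (v j))⁻¹ * f b) • v j + ∑ i ∈ s, c i • π (v i) := by
            rw [← hb, hπ]; abel
          rw [h1]
          conv_lhs => rw [h2]
          simp only [hπ, smul_sub, Finset.sum_sub_distrib, add_smul, Finset.sum_smul, smul_smul]
          rw [show ∑ i ∈ s, (c i * (-(f (v j))⁻¹ * f (v i))) • v j =
            -∑ i ∈ s, (c i * ((f (v j))⁻¹ * f (v i))) • v j by
              rw [← Finset.sum_neg_distrib]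
              exact Finset.sum_congr rfl fun i _ => by rw [← neg_smul]; ring_nf]
          abel
      · refine Or.inr ⟨g ∘ₗ π, fun i hi => ?_, hgb⟩
        rcases Finset.mem_insert.1 hi with rfl | hi
        · simp [hπ, inv_mul_cancel₀ hfj.ne]
        · exact hg i hi

/-- If the segment from the point `y` of a polytope to `p` leaves the polytope at `y`, then a
hyperplane through `y` that supports the polytope has `p` strictly on its other side. -/
theorem exists_supporting {A : Set E} (hA : A.Finite) {y p : E} (hy : y ∈ convexHull ℝ A)
    (h : ∀ ε : ℝ, 0 < ε → ε ≤ 1 → y + ε • (p - y) ∉ convexHull ℝ A) :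
    ∃ f : E →ₗ[ℝ] ℝ, (∀ a ∈ convexHull ℝ A, f y ≤ f a) ∧ f p < f y := by
  rcases farkas hA.toFinset (fun a => a - y) (p - y) with ⟨c, hc, hb⟩ | ⟨f, hf, hfb⟩
  · exfalso
    set S := ∑ a ∈ hA.toFinset, c a with hS
    have hS0 : 0 ≤ S := Finset.sum_nonneg hc
    have hpos : 0 < 1 + S := by linarith
    refine h (1 + S)⁻¹ (inv_pos.2 hpos) (inv_le_one_of_one_le₀ (by linarith)) ?_
    have : y + (1 + S)⁻¹ • (p - y) =
        (1 + S)⁻¹ • y + ∑ a ∈ hA.toFinset, ((1 + S)⁻¹ * c a) • a := by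
      rw [hb]
      simp only [smul_sub, Finset.sum_sub_distrib, ← Finset.sum_smul, ← hS, Finset.smul_sum,
        smul_smul]
      have : (1 : ℝ) = (1 + S)⁻¹ + (1 + S)⁻¹ * S := by field_simp
      nth_rw 1 [← one_smul ℝ y]
      nth_rw 1 [this]
      rw [add_smul]
      abel
    rw [this]
    have := (convex_convexHull ℝ A).sum_mem (t := Finset.insertNone hA.toFinset)
      (w := fun o : Option E => o.elim (1 + S)⁻¹ fun a => (1 + S)⁻¹ * c a)
      (z := fun o : Option E => o.elim y id) ?_ ?_ ?_
    · simpa [Finset.sum_insertNone] using this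
    · rintro (_ | a) ho
      · exact (inv_pos.2 hpos).le
      · exact mul_nonneg (inv_pos.2 hpos).le (hc a (by simpa using ho))
    · simp only [Finset.sum_insertNone, Option.elim, ← Finset.mul_sum, ← hS]
      field_simp
    · rintro (_ | a) ho
      · exact hy
      · exact subset_convexHull ℝ A (by simpa using ho)
  · refine ⟨f, ?_, by simpa using hfb⟩
    have : convexHull ℝ A ⊆ {x | f y ≤ f x} :=
      convexHull_min (fun a ha => by simpa using hf a (by simpa using ha))
        (convex_halfSpace_ge f.isLinear _)
    exact this

/-- A convex combination that lies in an extreme subset uses only points of the extreme subset. -/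
theorem mem_of_sum_mem_of_isExtreme {ι : Type*} {P G : Set E} (hP : Convex ℝ P)
    (hG : IsExtreme ℝ P G) {s : Finset ι} {w : ι → ℝ} {z : ι → E} (hw : ∀ i ∈ s, 0 ≤ w i)
    (h1 : ∑ i ∈ s, w i = 1) (hz : ∀ i ∈ s, z i ∈ P) (hmem : ∑ i ∈ s, w i • z i ∈ G)
    {i : ι} (hi : i ∈ s) (hwi : 0 < w i) : z i ∈ G := by
  classical
  have hs := Finset.add_sum_erase s w hi
  have hs' := Finset.add_sum_erase s (fun i => w i • z i) hi
  have hnn : 0 ≤ ∑ k ∈ s.erase i, w k :=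
    Finset.sum_nonneg fun k hk => hw k (Finset.mem_of_mem_erase hk)
  rcases hnn.eq_or_lt with h0 | h0
  · have hk : ∀ k ∈ s.erase i, w k = 0 := (Finset.sum_eq_zero_iff_of_nonneg
      fun k hk => hw k (Finset.mem_of_mem_erase hk)).1 h0.symm
    have : ∑ k ∈ s.erase i, w k • z k = 0 :=
      Finset.sum_eq_zero fun k hk' => by rw [hk k hk', zero_smul]
    have hwi1 : w i = 1 := by linarith
    simp only [this, hwi1, one_smul, add_zero] at hs'
    rwa [hs']
  · set r := ∑ k ∈ s.erase i, w k with hr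
    have hy : r⁻¹ • ∑ k ∈ s.erase i, w k • z k ∈ P := by
      rw [Finset.smul_sum]
      simp only [smul_smul]
      refine hP.sum_mem (fun k hk => mul_nonneg (inv_pos.2 h0).le
        (hw k (Finset.mem_of_mem_erase hk))) ?_ fun k hk => hz k (Finset.mem_of_mem_erase hk)
      rw [← Finset.mul_sum, ← hr, inv_mul_cancel₀ h0.ne']
    refine hG.left_mem_of_mem_openSegment (hz i hi) hy hmem
      ⟨w i, r, hwi, h0, by linarith, ?_⟩
    rw [smul_smul, mul_inv_cancel₀ h0.ne', one_smul, hs']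

/-- The part of a spanning set `A` that lies in a face spans the face. -/
theorem subset_convexHull_inter_of_isExtreme {A G : Set E}
    (hG : IsExtreme ℝ (convexHull ℝ A) G) : G ⊆ convexHull ℝ (A ∩ G) := by
  intro x hx
  obtain ⟨ι, s, w, z, hw, h1, hz, rfl⟩ := (mem_convexHull_iff_exists_fintype).1 (hG.subset hx)
  classical
  have hx' := hx
  rw [← Finset.sum_filter_of_ne (p := fun i => 0 < w i)] at hx' ⊢
  · refine (convex_convexHull ℝ _).sum_mem (fun i _ => hw i) ?_ fun i hi =>
      subset_convexHull ℝ _ ⟨hz i, ?_⟩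
    · rw [Finset.sum_filter_of_ne (p := fun i => 0 < w i), h1]
      exact fun i _ hi => (hw i).lt_of_ne' hi
    · exact mem_of_sum_mem_of_isExtreme (convex_convexHull ℝ A) hG (fun i _ => hw i) h1
        (fun i _ => subset_convexHull ℝ A (hz i)) hx (Finset.mem_univ i) (Finset.mem_filter.1 hi).2
  · exact fun i _ hi => (hw i).lt_of_ne' fun h => hi (by rw [h, zero_smul])
  · exact fun i _ hi => (hw i).lt_of_ne' fun h => hi (by rw [h, zero_smul])

end Polytopes

/-! ### Triangulations as bijective barycentric coordinates -/

section Representations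

variable {E : Type*} [AddCommGroup E] [Module ℝ E]

/-- The function `c` gives barycentric coordinates of the point `x` in a simplex of `T`: it is a
convex combination with value `x`, and the set of points with nonzero coefficients is in `T`. -/
structure IsRep (T : Set (Finset E)) (c : E →₀ ℝ) (x : E) : Prop where
  support_mem : c.support ∈ T
  nonneg : ∀ a, 0 ≤ c a
  total : Finsupp.linearCombination ℝ (fun _ : E => (1 : ℝ)) c = 1
  bary : Finsupp.linearCombination ℝ (id : E → E) c = x

/-- A set `T` of finite sets triangulates `P` if it is closed under passing to nonempty subsets
and every point of `P` has unique barycentric coordinates in the simplices of `T`. That the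
simplices are affinely independent and intersect in common faces is then automatic. -/
structure Triangulates (T : Set (Finset E)) (P : Set E) : Prop where
  nonempty : ∀ τ ∈ T, τ.Nonempty
  down_closed : ∀ τ ∈ T, ∀ ρ ⊆ τ, ρ.Nonempty → ρ ∈ T
  subset : ∀ τ ∈ T, (τ : Set E) ⊆ P
  exists_rep : ∀ x ∈ P, ∃ c, IsRep T c x
  unique : ∀ c c' x, IsRep T c x → IsRep T c' x → c = c'

variable {T T' : Set (Finset E)} {P : Set E} {c c' : E →₀ ℝ} {x y p : E}

theorem IsRep.sum_eq_one (h : IsRep T c x) : ∑ a ∈ c.support, c a = 1 := by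
  simpa [Finsupp.linearCombination_apply, Finsupp.sum] using h.total

theorem IsRep.sum_smul_eq (h : IsRep T c x) : ∑ a ∈ c.support, c a • a = x := by
  simpa [Finsupp.linearCombination_apply, Finsupp.sum] using h.bary

theorem IsRep.mem_convexHull (h : IsRep T c x) : x ∈ convexHull ℝ (c.support : Set E) :=
  Finset.mem_convexHull'.2 ⟨c, fun a _ => h.nonneg a, h.sum_eq_one, h.sum_smul_eq⟩

theorem IsRep.mem {G : Set E} (h : IsRep T c x) (hG : Convex ℝ G)
    (hc : (c.support : Set E) ⊆ G) : x ∈ G :=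
  convexHull_min hc hG h.mem_convexHull

theorem IsRep.support_subset {P G : Set E} (h : IsRep T c x) (hP : Convex ℝ P)
    (hG : IsExtreme ℝ P G) (hc : (c.support : Set E) ⊆ P) (hx : x ∈ G) :
    (c.support : Set E) ⊆ G := fun a ha =>
  mem_of_sum_mem_of_isExtreme (z := id) hP hG (fun a _ => h.nonneg a) h.sum_eq_one
    (fun _ ha => hc ha) (by simpa [h.sum_smul_eq] using hx) ha
    ((h.nonneg a).lt_of_ne' (Finsupp.mem_support_iff.1 ha))

theorem IsRep.mono (h : IsRep T c x) (hc : c.support ∈ T') : IsRep T' c x :=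
  ⟨hc, h.nonneg, h.total, h.bary⟩

theorem isRep_single (hp : {p} ∈ T) : IsRep T (Finsupp.single p 1) p := by
  classical
  refine ⟨by rwa [Finsupp.support_single p one_ne_zero], fun a => ?_, by simp, by simp⟩
  rw [Finsupp.single_apply]
  split <;> norm_num

/-- A convex combination over a simplex of a down-closed `T`, as barycentric coordinates. -/
theorem exists_isRep_of_sum (hT : ∀ τ ∈ T, ∀ ρ ⊆ τ, ρ.Nonempty → ρ ∈ T) {s : Finset E}
    (hs : s ∈ T) {u : E → ℝ} (hu : ∀ a ∈ s, 0 ≤ u a) (h1 : ∑ a ∈ s, u a = 1)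
    (hx : ∑ a ∈ s, u a • a = x) :
    ∃ c, IsRep T c x ∧ c.support ⊆ s ∧ ∀ a ∈ s, c a = u a := by
  classical
  let c : E →₀ ℝ := Finsupp.onFinset s (fun a => if a ∈ s then u a else 0) fun a ha => by
    by_contra h
    simp [h] at ha
  have hc : ∀ a ∈ s, c a = u a := fun a ha => by simp [c, ha]
  have hsub : c.support ⊆ s := Finsupp.support_onFinset_subset
  have h1' : Finsupp.linearCombination ℝ (fun _ : E => (1 : ℝ)) c = 1 := by
    rw [Finsupp.linearCombination_apply, Finsupp.sum_of_support_subset c hsub _ (by simp)]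
    refine Eq.trans ?_ h1
    exact Finset.sum_congr rfl fun a ha => by simp [hc a ha]
  refine ⟨c, ⟨hT s hs _ hsub ?_, fun a => ?_, h1', ?_⟩, hsub, hc⟩
  · rw [Finsupp.support_nonempty_iff]
    rintro h
    simp [h] at h1'
  · by_cases ha : a ∈ s
    · rw [hc a ha]; exact hu a ha
    · simp [c, ha]
  · rw [Finsupp.linearCombination_apply, Finsupp.sum_of_support_subset c hsub _ (by simp), ← hx]
    exact Finset.sum_congr rfl fun a ha => by simp [hc a ha]

theorem Triangulates.exists_isRep (hT : Triangulates T P) {s : Finset E} (hs : s ∈ T)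
    (hx : x ∈ convexHull ℝ (s : Set E)) : ∃ c, IsRep T c x ∧ c.support ⊆ s := by
  obtain ⟨u, hu, h1, h2⟩ := Finset.mem_convexHull'.1 hx
  obtain ⟨c, hc, hs, -⟩ := exists_isRep_of_sum hT.down_closed hs hu h1 h2
  exact ⟨c, hc, hs⟩

theorem Triangulates.affineIndependent (hT : Triangulates T P) {s : Finset E}
    (hs : s ∈ T) : AffineIndependent ℝ ((↑) : s → E) := by
  rw [affineIndependent_iff]
  -- A dependence `w` would give a second convex combination next to the one with coefficients
  -- proportional to `|w| + 1`.
  intro t w hw hx a ha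
  classical
  let v : E → ℝ := fun a => if h : a ∈ s then if (⟨a, h⟩ : s) ∈ t then w ⟨a, h⟩ else 0 else 0
  have hv : ∀ a : s, v a = if a ∈ t then w a else 0 := fun a => by simp [v]
  have hv0 : ∑ a ∈ s, v a = 0 := by
    rw [← Finset.sum_coe_sort]
    simp only [hv]
    rw [Finset.sum_ite_mem, Finset.univ_inter, hw]
  have hvx : ∑ a ∈ s, v a • a = 0 := by
    rw [← Finset.sum_coe_sort]
    simp only [hv, ite_smul, zero_smul]
    rw [Finset.sum_ite_mem, Finset.univ_inter]
    exact hx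
  set N := ∑ a ∈ s, (|v a| + 1) with hN
  have hNpos : 0 < N := Finset.sum_pos (fun a _ => by positivity) (hT.nonempty s hs)
  obtain ⟨c, hc, -, hcs⟩ := exists_isRep_of_sum hT.down_closed hs
    (u := fun a => N⁻¹ * (|v a| + 1)) (fun a _ => by positivity)
    (by rw [← Finset.mul_sum, ← hN, inv_mul_cancel₀ hNpos.ne']) rfl
  obtain ⟨c', hc', -, hcs'⟩ := exists_isRep_of_sum hT.down_closed hs
    (u := fun a => N⁻¹ * (|v a| + 1) + N⁻¹ * v a)
    (x := ∑ a ∈ s, (N⁻¹ * (|v a| + 1)) • a)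
    (fun a _ => by
      rw [← mul_add]
      have := neg_abs_le (v a)
      exact mul_nonneg (inv_pos.2 hNpos).le (by linarith))
    (by rw [Finset.sum_add_distrib, ← Finset.mul_sum, ← Finset.mul_sum, ← hN, hv0,
          inv_mul_cancel₀ hNpos.ne', mul_zero, add_zero])
    (by simp only [add_smul, Finset.sum_add_distrib, mul_smul N⁻¹ (v _), ← Finset.smul_sum, hvx,
          smul_zero, add_zero])
  have h := hcs a a.2
  rw [hT.unique c c' _ hc hc', hcs' a a.2, hv, if_pos ha] at h
  have : N⁻¹ * w a = 0 := by linarith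
  exact (mul_eq_zero.1 this).resolve_left (inv_ne_zero hNpos.ne')

theorem Triangulates.isTriangulation {A : Set E} (hA : A.Finite)
    (hT : Triangulates T (convexHull ℝ A)) (hTA : ∀ τ ∈ T, (τ : Set E) ⊆ A) :
    IsTriangulation A T := by
  let K : Geometry.SimplicialComplex ℝ E :=
    { faces := T
      isRelLowerSet_faces := by
        intro s hs
        exact ⟨hT.nonempty s hs, fun t hts ht => hT.down_closed s hs t hts ht⟩
      indep := hT.affineIndependent
      inter_subset_convexHull := by
        rintro s t hs ht x ⟨hxs, hxt⟩
        obtain ⟨c, hc, hcs⟩ := hT.exists_isRep hs hxs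
        obtain ⟨c', hc', hct⟩ := hT.exists_isRep ht hxt
        obtain rfl := hT.unique _ _ _ hc hc'
        refine convexHull_mono ?_ hc.mem_convexHull
        exact fun a ha => ⟨hcs ha, hct ha⟩ }
  refine ⟨hA, K, rfl, fun x hx => hTA _ (show {x} ∈ T from hx) (by simp), ?_⟩
  · refine Set.Subset.antisymm (Set.iUnion₂_subset fun s hs => ?_) fun x hx => ?_
    · exact convexHull_min (hT.subset s hs) (convex_convexHull ℝ A)
    · obtain ⟨c, hc⟩ := hT.exists_rep x hx
      exact Set.mem_iUnion₂.2 ⟨c.support, hc.support_mem, hc.mem_convexHull⟩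

theorem IsRep.join (h : IsRep T c y) (hp : p ∉ c.support) {t : ℝ} (ht0 : 0 < t) (ht1 : t < 1)
    (hT' : ∀ τ : Finset E, (τ : Set E) = insert p (c.support : Set E) → τ ∈ T') :
    IsRep T' (Finsupp.single p t + (1 - t) • c) (t • p + (1 - t) • y) := by
  classical
  refine ⟨hT' _ ?_, fun a => ?_, ?_, ?_⟩
  · ext a
    rcases eq_or_ne a p with rfl | ha
    · simp [Finsupp.notMem_support_iff.1 hp, ht0.ne']
    · simp [ha, sub_ne_zero.2 ht1.ne']
  · have h1 : 0 ≤ Finsupp.single p t a := by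
      rw [Finsupp.single_apply]
      split <;> linarith
    have := mul_nonneg (sub_nonneg.2 ht1.le) (h.nonneg a)
    simpa using add_nonneg h1 this
  · simp [h.total]
  · simp [h.bary]

theorem IsRep.exists_join (h : IsRep T c x) {ρ : Finset E} (hρ : ρ.Nonempty) (hp : p ∉ ρ)
    (hc : (c.support : Set E) = insert p (ρ : Set E)) (hρT : ρ ∈ T') :
    ∃ t c₁ y, 0 < t ∧ t < 1 ∧ IsRep T' c₁ y ∧ c₁.support = ρ ∧
      c = Finsupp.single p t + (1 - t) • c₁ := by
  classical
  have hc' : c.support = insert p ρ := Finset.coe_injective (by simpa using hc)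
  have hsum := h.sum_eq_one
  rw [hc', Finset.sum_insert hp] at hsum
  have hpos : ∀ a ∈ insert p ρ, 0 < c a := fun a ha =>
    (h.nonneg a).lt_of_ne' (Finsupp.mem_support_iff.1 (hc' ▸ ha))
  have hρ0 : 0 < ∑ a ∈ ρ, c a :=
    Finset.sum_pos (fun a ha => hpos a (Finset.mem_insert_of_mem ha)) hρ
  have ht1 : 0 < 1 - c p := by linarith
  have hsplit := Finsupp.single_add_erase p c
  have htot := h.total
  rw [← hsplit, map_add] at htot
  simp only [Finsupp.linearCombination_single, smul_eq_mul, mul_one] at htot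
  have hsupp : ((1 - c p)⁻¹ • c.erase p).support = ρ := by
    rw [Finsupp.support_smul_eq (inv_ne_zero ht1.ne'), Finsupp.support_erase, hc',
      Finset.erase_insert hp]
  refine ⟨c p, (1 - c p)⁻¹ • c.erase p, _, hpos p (Finset.mem_insert_self _ _), by linarith,
    ⟨hsupp ▸ hρT, fun a => ?_, ?_, rfl⟩, hsupp, ?_⟩
  · rw [Finsupp.smul_apply, smul_eq_mul]
    refine mul_nonneg (inv_pos.2 ht1).le ?_
    rw [Finsupp.erase_apply]
    split
    exacts [le_rfl, h.nonneg a]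
  · rw [map_smul, smul_eq_mul, show Finsupp.linearCombination ℝ (fun _ : E => (1 : ℝ)) (c.erase p)
      = 1 - c p by linarith, inv_mul_cancel₀ ht1.ne']
  · rw [smul_smul, mul_inv_cancel₀ ht1.ne', one_smul, hsplit]

end Representations

/-! ### Placing -/

section Placing

variable {E : Type*} [AddCommGroup E] [Module ℝ E]
variable {T : Set (Finset E)} {c : E →₀ ℝ} {x p : E} {A : Set E}

theorem eq_of_join_eq {t : ℝ} {y y' : E} (ht : t < 1)
    (h : t • p + (1 - t) • y = t • p + (1 - t) • y') : y = y' :=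
  smul_right_injective E (sub_pos.2 ht).ne' (add_left_cancel h)

/-- The barycentric coordinates in a placing triangulation are those of a point of the original
triangulation, moved towards the placed point, which sees the carrier of that point. -/
theorem IsRep.of_place (hT : ∀ τ ∈ T, τ.Nonempty) (hpT : ∀ τ ∈ T, p ∉ τ)
    (h : IsRep (place T p) c x) :
    c = Finsupp.single p 1 ∨ ∃ t c₁ y, 0 ≤ t ∧ t < 1 ∧ IsRep T c₁ y ∧
      c = Finsupp.single p t + (1 - t) • c₁ ∧ (t = 0 ∨ IsVisible T p c₁.support) := by
  rcases h.support_mem with (hc | hc) | ⟨ρ, hρ, hvis, hc⟩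
  · exact Or.inr ⟨0, c, x, le_rfl, one_pos, h.mono hc, by simp, Or.inl rfl⟩
  · left
    have hs : c = Finsupp.single p (c p) :=
      Finsupp.eq_single_iff.2 ⟨fun a ha => by
        have : a ∈ (c.support : Set E) := ha
        rw [hc] at this
        simpa using this, rfl⟩
    have htot := h.total
    rw [hs, Finsupp.linearCombination_single, smul_eq_mul, mul_one] at htot
    rw [hs, htot]
  · right
    obtain ⟨t, c₁, y, ht0, ht1, h₁, hsupp, hcc⟩ := h.exists_join (hT ρ hρ) (hpT ρ hρ) hc hρ
    exact ⟨t, c₁, y, ht0.le, ht1, h₁, hcc, Or.inr (hsupp ▸ hvis)⟩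

/-- The segment from `p` to a point `z` of a polytope that does not contain `p` has a first point
in the polytope. -/
theorem exists_first_hit [TopologicalSpace E] [IsTopologicalAddGroup E] [ContinuousSMul ℝ E]
    [T2Space E] (hA : A.Finite) {z : E} (hz : z ∈ convexHull ℝ A) :
    ∃ θ : ℝ, 0 ≤ θ ∧ θ ≤ 1 ∧ p + θ • (z - p) ∈ convexHull ℝ A ∧
      ∀ η, 0 ≤ η → η < θ → p + η • (z - p) ∉ convexHull ℝ A := by
  have hcl : IsClosed (convexHull ℝ A) := (hA.isCompact_convexHull (𝕜 := ℝ)).isClosed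
  have hK : IsCompact (Set.Icc (0 : ℝ) 1 ∩ (fun θ : ℝ => p + θ • (z - p)) ⁻¹' convexHull ℝ A) :=
    isCompact_Icc.inter_right (hcl.preimage (by fun_prop))
  obtain ⟨θ, ⟨⟨h0, h1⟩, hθ⟩, hmin⟩ := hK.exists_isLeast ⟨1, by simp, by simpa using hz⟩
  exact ⟨θ, h0, h1, hθ, fun η hη hlt hmem =>
    hlt.not_ge (hmin ⟨⟨hη, hlt.le.trans h1⟩, hmem⟩)⟩

theorem Triangulates.place [TopologicalSpace E] [IsTopologicalAddGroup E] [ContinuousSMul ℝ E]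
    [T2Space E] (hA : A.Finite) (hT : Triangulates T (convexHull ℝ A))
    (hp : p ∉ convexHull ℝ A) : Triangulates (place T p) (convexHull ℝ (insert p A)) := by
  classical
  have hsub : convexHull ℝ A ⊆ convexHull ℝ (insert p A) := convexHull_mono (Set.subset_insert _ _)
  have hpmem : p ∈ convexHull ℝ (insert p A) := subset_convexHull ℝ _ (Set.mem_insert _ _)
  have hpT : ∀ τ ∈ T, p ∉ τ := fun τ hτ h => hp (hT.subset τ hτ h)
  have hvis : ∀ ρ τ, IsVisible T p ρ → τ ⊆ ρ → IsVisible T p τ :=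
    fun ρ τ ⟨f, d, h1, h2, h3⟩ h => ⟨f, d, h1, fun b hb => h2 b (h hb), h3⟩
  refine ⟨?_, ?_, ?_, ?_, ?_⟩
  · rintro τ ((hτ | hτ) | ⟨ρ, -, -, hτ⟩)
    · exact hT.nonempty τ hτ
    · exact ⟨p, by rw [← Finset.mem_coe, hτ]; rfl⟩
    · exact ⟨p, by rw [← Finset.mem_coe, hτ]; exact Set.mem_insert _ _⟩
  · rintro τ ((hτ | hτ) | ⟨ρ, hρ, hρv, hτ⟩) σ hσ hne
    · exact Or.inl (Or.inl (hT.down_closed τ hτ σ hσ hne))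
    · have : τ = {p} := Finset.coe_injective (by simpa using hτ)
      rw [this] at hσ
      refine Or.inl (Or.inr ?_)
      rw [(Finset.Nonempty.subset_singleton_iff hne).1 hσ]
      exact Finset.coe_singleton p
    · obtain rfl : τ = insert p ρ := Finset.coe_injective (by simpa using hτ)
      have hσρ : σ.erase p ⊆ ρ := Finset.subset_insert_iff.1 hσ
      by_cases hpσ : p ∈ σ
      · rcases (σ.erase p).eq_empty_or_nonempty with h0 | h0
        · refine Or.inl (Or.inr ?_)
          rw [← Finset.insert_erase hpσ, h0]
          simp
        · refine Or.inr ⟨σ.erase p, hT.down_closed ρ hρ _ hσρ h0, hvis _ _ hρv hσρ, ?_⟩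
          rw [← Finset.coe_insert, Finset.insert_erase hpσ]
      · rw [Finset.erase_eq_of_notMem hpσ] at hσρ
        exact Or.inl (Or.inl (hT.down_closed ρ hρ σ hσρ hne))
  · rintro τ ((hτ | hτ) | ⟨ρ, hρ, -, hτ⟩)
    · exact (hT.subset τ hτ).trans hsub
    · rw [hτ]
      exact Set.singleton_subset_iff.2 hpmem
    · rw [hτ]
      exact Set.insert_subset hpmem ((hT.subset ρ hρ).trans hsub)
  · intro x hx
    rcases A.eq_empty_or_nonempty with rfl | hne
    · obtain rfl : x = p := by simpa using hx
      exact ⟨_, isRep_single (Or.inl (Or.inr (Finset.coe_singleton x)))⟩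
    rw [convexHull_insert hne, mem_convexJoin] at hx
    obtain ⟨p', hp', z, hz, hx⟩ := hx
    obtain rfl : p' = p := hp'
    rw [segment_eq_image'] at hx
    obtain ⟨s, ⟨hs0, hs1⟩, rfl⟩ := hx
    obtain ⟨θ, h0, h1, hθ, hmin⟩ := exists_first_hit (p := p') hA hz
    dsimp only
    rcases hs0.eq_or_lt with rfl | hs0
    · rw [zero_smul, add_zero]
      refine ⟨Finsupp.single p' 1, ?_⟩
      exact isRep_single (Or.inl (Or.inr (Finset.coe_singleton p')))
    by_cases hsθ : θ ≤ s
    · -- beyond the first point, the segment stays in the polytope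
      have : p' + s • (z - p') ∈ convexHull ℝ A := by
        rcases hsθ.eq_or_lt with rfl | hlt
        · exact hθ
        have hpos : 0 < 1 - θ := by linarith
        convert! (convex_convexHull ℝ A) hθ hz (a := (1 - s) / (1 - θ)) (b := (s - θ) / (1 - θ))
          (div_nonneg (by linarith) hpos.le) (div_nonneg (by linarith) hpos.le)
          (by field_simp; ring) using 1
        match_scalars <;> field_simp <;> ring
      obtain ⟨c, hc⟩ := hT.exists_rep _ this
      exact ⟨c, hc.mono (Or.inl (Or.inl hc.support_mem))⟩
    · push Not at hsθ
      have hθ0 : 0 < θ := hs0.trans hsθ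
      obtain ⟨f, hf, hfp⟩ := exists_supporting (p := p') hA hθ fun ε hε hε1 => by
        have := hmin (θ * (1 - ε)) (mul_nonneg h0 (by linarith)) (by nlinarith)
        convert this using 2
        module
      obtain ⟨c, hc⟩ := hT.exists_rep _ hθ
      have hcs : ∀ b ∈ c.support, f b = f (p' + θ • (z - p')) := fun b hb => by
        have hext : IsExtreme ℝ (convexHull ℝ A)
            {b ∈ convexHull ℝ A | f b = f (p' + θ • (z - p'))} := by
          refine ⟨fun b hb => hb.1, ?_⟩
          rintro u hu v hv w ⟨-, hw⟩ ⟨a, b, ha, hb, hab, rfl⟩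
          refine ⟨hu, le_antisymm ?_ (hf u hu)⟩
          rw [← hw, map_add, map_smul, map_smul, smul_eq_mul, smul_eq_mul]
          have := hf v hv
          have h3 := hf u hu
          rw [← hw, map_add, map_smul, map_smul, smul_eq_mul, smul_eq_mul] at this h3
          obtain rfl : b = 1 - a := by linarith
          nlinarith
        exact (hc.support_subset (convex_convexHull ℝ A) hext (hT.subset _ hc.support_mem)
          ⟨hθ, rfl⟩ hb).2
      have hpc : p' ∉ c.support := hpT _ hc.support_mem
      have ht0 : 0 < 1 - s / θ := by rw [sub_pos, div_lt_one hθ0]; exact hsθ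
      have ht1 : 1 - s / θ < 1 := by linarith [div_pos hs0 hθ0]
      refine ⟨Finsupp.single p' (1 - s / θ) + (1 - (1 - s / θ)) • c, ?_⟩
      convert! hc.join hpc ht0 ht1 (T' := BirkhoffFour.place T p') fun τ hτ =>
        Or.inr ⟨c.support, hc.support_mem, ⟨f, _, fun ρ hρ a ha => hf a (hT.subset ρ hρ ha),
          hcs, hfp⟩, hτ⟩ using 1
      match_scalars <;> field_simp <;> ring
  · -- A functional that certifies visibility of the carrier of `y` bounds the weight of `p`.
    have key : ∀ {t t' : ℝ} {c₁ y c₂ y'}, IsRep T c₁ y → IsRep T c₂ y' → 0 ≤ t' → t' < 1 →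
        (t = 0 ∨ IsVisible T p c₁.support) →
        t • p + (1 - t) • y = t' • p + (1 - t') • y' → t ≤ t' := by
      rintro t t' c₁ y c₂ y' h₁ h₂ ht' ht'1 (rfl | ⟨f, d, hf, hd, hfp⟩) hxy
      · exact ht'
      have hy : f y = d := h₁.mem (G := {x | f x = d}) (convex_hyperplane f.isLinear _) hd
      have hy' : d ≤ f y' := h₂.mem (G := {x | d ≤ f x}) (convex_halfSpace_ge f.isLinear _)
        fun a ha => hf _ h₂.support_mem a ha
      have hf := congrArg f hxy
      simp only [map_add, map_smul, smul_eq_mul, hy] at hf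
      by_contra! hlt
      nlinarith [mul_pos (sub_pos.2 hlt) (sub_pos.2 hfp),
        mul_nonneg (sub_nonneg.2 ht'1.le) (sub_nonneg.2 hy')]
    have hy : ∀ {c₁ y}, IsRep T c₁ y → y ≠ p := fun h₁ h => hp <| h ▸
      h₁.mem (convex_convexHull ℝ A) (hT.subset _ h₁.support_mem)
    intro c c' x h h'
    have hx := h.bary.trans h'.bary.symm
    rcases h.of_place hT.nonempty hpT with rfl | ⟨t, c₁, y, ht0, ht1, h₁, rfl, hv⟩ <;>
      rcases h'.of_place hT.nonempty hpT with rfl | ⟨t', c₂, y', ht0', ht1', h₂, rfl, hv'⟩ <;>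
      simp only [map_add, map_smul, Finsupp.linearCombination_single, id, one_smul] at hx
    · rfl
    · rw [h₂.bary] at hx
      exact (hy h₂ (eq_of_join_eq ht1' (by rw [← hx]; module))).elim
    · rw [h₁.bary] at hx
      exact (hy h₁ (eq_of_join_eq ht1 (by rw [hx]; module))).elim
    · rw [h₁.bary, h₂.bary] at hx
      obtain rfl := le_antisymm (key h₁ h₂ ht0' ht1' hv hx) (key h₂ h₁ ht0 ht1 hv' hx.symm)
      obtain rfl := eq_of_join_eq ht1 hx
      rw [hT.unique _ _ _ h₁ h₂]

/-- Placing one after the other points in convex position, outside the polytope spanned by the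
points used before, extends a triangulation. -/
theorem Triangulates.placing [TopologicalSpace E] [IsTopologicalAddGroup E]
    [ContinuousSMul ℝ E] [T2Space E] {V : Set E} (hV : V.Finite)
    (hext : ∀ v ∈ V, v ∉ convexHull ℝ (V \ {v})) (l : List E) (hl : l.Nodup) (hlV : ∀ v ∈ l, v ∈ V)
    (hAV : A ⊆ V) (hlA : ∀ v ∈ l, v ∉ A) (hT : Triangulates T (convexHull ℝ A)) :
    Triangulates (placing T l) (convexHull ℝ (A ∪ {v | v ∈ l})) := by
  induction l generalizing T A with
  | nil => simpa [BirkhoffFour.placing] using hT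
  | cons p l ih =>
    have hAp : A ⊆ V \ {p} := fun a ha =>
      ⟨hAV ha, fun h => hlA p (by simp) (Set.mem_singleton_iff.1 h ▸ ha)⟩
    have hp : p ∉ convexHull ℝ A := fun h => hext p (hlV p (by simp)) (convexHull_mono hAp h)
    have := ih (List.nodup_cons.1 hl).2 (fun v hv => hlV v (by simp [hv]))
      (Set.insert_subset (hlV p (by simp)) hAV)
      (fun v hv hvA => by
        rcases hvA with rfl | hvA
        · exact (List.nodup_cons.1 hl).1 hv
        · exact hlA v (by simp [hv]) hvA)
      (hT.place (hV.subset hAV) hp)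
    have hset : A ∪ {v | v ∈ p :: l} = insert p A ∪ {v | v ∈ l} := by
      ext v
      simp only [List.mem_cons, Set.mem_union, Set.mem_insert_iff, Set.mem_ofPred_eq]
      tauto
    rw [hset]
    exact this

theorem mem_of_mem_placing {l : List E} {V : Set E} (hT : ∀ τ ∈ T, (τ : Set E) ⊆ V)
    (hl : ∀ v ∈ l, v ∈ V) : ∀ τ ∈ placing T l, (τ : Set E) ⊆ V := by
  induction l generalizing T with
  | nil => exact hT
  | cons p l ih =>
    refine ih ?_ fun v hv => hl v (by simp [hv])
    have hp := hl p (by simp)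
    rintro τ ((hτ | hτ) | ⟨ρ, hρ, -, hτ⟩)
    · exact hT τ hτ
    · rw [hτ]; exact Set.singleton_subset_iff.2 hp
    · rw [hτ]; exact Set.insert_subset hp (hT ρ hρ)

/-- Placing points outside a set `F` does not add simplices contained in `F`. -/
theorem placing_inter {l : List E} {F : Set E} (hl : ∀ v ∈ l, v ∉ F) :
    {τ ∈ placing T l | (τ : Set E) ⊆ F} = {τ ∈ T | (τ : Set E) ⊆ F} := by
  induction l generalizing T with
  | nil => rfl
  | cons p l ih =>
    have hp := hl p (by simp)
    refine (ih fun v hv => hl v (by simp [hv])).trans (Set.ext fun τ => ?_)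
    refine ⟨?_, fun h => ⟨Or.inl (Or.inl h.1), h.2⟩⟩
    rintro ⟨(hτ | hτ) | ⟨ρ, -, -, hτ⟩, hF⟩
    · exact ⟨hτ, hF⟩
    · exact (hp (hF (by rw [hτ]; rfl))).elim
    · exact (hp (hF (by rw [hτ]; exact Set.mem_insert _ _))).elim

end Placing

/-! ### Pulling -/

section Pulling

variable {E : Type*} [AddCommGroup E] [Module ℝ E] [TopologicalSpace E]
variable {T : Set (Finset E)} {c : E →₀ ℝ} {x p : E} {A P Q F G : Set E}

theorem subset_of_mem_pulling (l : List E) : ∀ τ ∈ pulling T l P, (τ : Set E) ⊆ P := by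
  induction l generalizing P with
  | nil => exact fun τ hτ => hτ.2
  | cons p l ih =>
    rintro τ (⟨-, hτ⟩ | ⟨hp, hτ | ⟨G, hG, -, hτ | ⟨ρ, hρ, hτ⟩⟩⟩)
    · exact ih τ hτ
    · rw [hτ]; exact Set.singleton_subset_iff.2 hp
    · exact (ih τ hτ).trans hG.subset
    · rw [hτ]; exact Set.insert_subset hp ((ih ρ hρ).trans hG.subset)

theorem nonempty_of_mem_pulling (hT : ∀ τ ∈ T, τ.Nonempty) (l : List E) :
    ∀ τ ∈ pulling T l P, τ.Nonempty := by
  induction l generalizing P with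
  | nil => exact fun τ hτ => hT τ hτ.1
  | cons p l ih =>
    rintro τ (⟨-, hτ⟩ | ⟨hp, hτ | ⟨G, hG, -, hτ | ⟨ρ, hρ, hτ⟩⟩⟩)
    · exact ih τ hτ
    · exact ⟨p, by rw [← Finset.mem_coe, hτ]; rfl⟩
    · exact ih τ hτ
    · exact ⟨p, by rw [← Finset.mem_coe, hτ]; exact Set.mem_insert _ _⟩

theorem pulling_down_closed (hT : ∀ τ ∈ T, ∀ ρ ⊆ τ, ρ.Nonempty → ρ ∈ T) (l : List E) :
    ∀ τ ∈ pulling T l P, ∀ ρ ⊆ τ, ρ.Nonempty → ρ ∈ pulling T l P := by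
  classical
  induction l generalizing P with
  | nil => exact fun τ hτ ρ hρ hne => ⟨hT τ hτ.1 ρ hρ hne, (Finset.coe_subset.2 hρ).trans hτ.2⟩
  | cons p l ih =>
    rintro τ (⟨hp, hτ⟩ | ⟨hp, hτ | ⟨G, hG, hpG, hτ | ⟨ρ, hρ, hτ⟩⟩⟩) σ hσ hne
    · exact Or.inl ⟨hp, ih τ hτ σ hσ hne⟩
    · have : τ = {p} := Finset.coe_injective (by simpa using hτ)
      rw [this] at hσ
      refine Or.inr ⟨hp, Or.inl ?_⟩
      rw [(Finset.Nonempty.subset_singleton_iff hne).1 hσ]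
      exact Finset.coe_singleton p
    · exact Or.inr ⟨hp, Or.inr ⟨G, hG, hpG, Or.inl (ih τ hτ σ hσ hne)⟩⟩
    · obtain rfl : τ = insert p ρ := Finset.coe_injective (by simpa using hτ)
      have hσρ : σ.erase p ⊆ ρ := Finset.subset_insert_iff.1 hσ
      by_cases hpσ : p ∈ σ
      · rcases (σ.erase p).eq_empty_or_nonempty with h0 | h0
        · refine Or.inr ⟨hp, Or.inl ?_⟩
          rw [← Finset.insert_erase hpσ, h0]
          simp
        · refine Or.inr ⟨hp, Or.inr ⟨G, hG, hpG, Or.inr ⟨σ.erase p, ih ρ hρ _ hσρ h0, ?_⟩⟩⟩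
          rw [← Finset.coe_insert, Finset.insert_erase hpσ]
      · rw [Finset.erase_eq_of_notMem hpσ] at hσρ
        exact Or.inr ⟨hp, Or.inr ⟨G, hG, hpG, Or.inl (ih ρ hρ σ hσρ hne)⟩⟩

/-- A ray from a point `p` through another point `x` of a polytope leaves the polytope
at a point `y` of an exposed face that does not contain `p`. -/
theorem exists_face_of_ray [IsTopologicalAddGroup E] [ContinuousSMul ℝ E] [T2Space E]
    [FiniteDimensional ℝ E] (hA : A.Finite) (hx : x ∈ convexHull ℝ A)
    (hxp : x ≠ p) : ∃ (t : ℝ) (y : E) (G : Set E), 0 ≤ t ∧ t < 1 ∧ IsExposed ℝ (convexHull ℝ A) G ∧ p ∉ G ∧ y ∈ G ∧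
      x = t • p + (1 - t) • y := by
  have hcp : IsCompact (convexHull ℝ A) := hA.isCompact_convexHull (𝕜 := ℝ)
  have hK : IsCompact ((Set.Icc (0 : ℝ) 1 ×ˢ convexHull ℝ A) ∩
      {q : ℝ × E | p + q.1 • (q.2 - p) = x}) :=
    (isCompact_Icc.prod hcp).inter_right (isClosed_eq (by fun_prop) continuous_const)
  obtain ⟨⟨s, y⟩, ⟨⟨⟨hs0, hs1⟩, hy⟩, hxy⟩, hmin⟩ := hK.exists_isMinOn
    (f := Prod.fst) ⟨(1, x), ⟨⟨by simp, hx⟩, by simp⟩⟩ continuous_fst.continuousOn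
  simp only [Set.mem_ofPred_eq] at hxy hs0 hs1 hy
  have hs : 0 < s := hs0.lt_of_ne fun h => hxp (by rw [← hxy, ← h, zero_smul, add_zero])
  obtain ⟨f, hf, hfp⟩ := exists_supporting (p := y + (y - p)) hA hy fun ε hε _ hmem => by
    have hlt : s / (1 + ε) < s := div_lt_self hs (by linarith)
    have hle : s ≤ s / (1 + ε) := hmin (a := (s / (1 + ε), y + ε • (y + (y - p) - y)))
      ⟨⟨⟨by positivity, hlt.le.trans hs1⟩, hmem⟩, by
        simp only [Set.mem_ofPred_eq]
        rw [← hxy]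
        match_scalars <;> field_simp <;> ring⟩
    exact hlt.not_ge hle
  have hfp' : f y < f p := by
    simp only [map_add, map_sub] at hfp
    linarith
  let g : StrongDual ℝ E := LinearMap.toContinuousLinearMap (-f)
  have hg : ∀ z, g z = -f z := fun z => rfl
  refine ⟨1 - s, y, g.toExposed _, by linarith, by linarith,
    ContinuousLinearMap.toExposed.isExposed, fun h => ?_, ⟨hy, fun z hz => ?_⟩, ?_⟩
  · have := h.2 y hy
    rw [hg, hg] at this
    linarith
  · rw [hg, hg]
    linarith [hf z hz]
  · rw [← hxy]
    module

/-- Barycentric coordinates in a pulling triangulation of a face `G` are those of a point `y` of a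
face `G₁` that does not contain `p`, moved towards `p`. -/
theorem IsRep.of_pulling (hT : ∀ τ ∈ T, τ.Nonempty) (l : List E)
    (hG : Convex ℝ G) (hGQ : IsExtreme ℝ Q G) (h : IsRep (pulling T (p :: l) G) c x) :
    (c = Finsupp.single p 1 ∧ p ∈ Q) ∨ ∃ t c₁ y G₁, 0 ≤ t ∧ t < 1 ∧ Convex ℝ G₁ ∧
      IsExtreme ℝ Q G₁ ∧ p ∉ G₁ ∧ IsRep (pulling T l G₁) c₁ y ∧
      c = Finsupp.single p t + (1 - t) • c₁ ∧ (t = 0 ∨ p ∈ Q) := by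
  rcases h.support_mem with ⟨hp, hc⟩ | ⟨hp, hc | ⟨G₁, hG₁, hpG₁, hc | ⟨ρ, hρ, hc⟩⟩⟩
  · exact Or.inr ⟨0, c, x, G, le_rfl, one_pos, hG, hGQ, hp, h.mono hc, by simp, Or.inl rfl⟩
  · left
    have hs : c = Finsupp.single p (c p) :=
      Finsupp.eq_single_iff.2 ⟨fun a ha => by
        have : a ∈ (c.support : Set E) := ha
        rw [hc] at this
        simpa using this, rfl⟩
    have htot := h.total
    rw [hs, Finsupp.linearCombination_single, smul_eq_mul, mul_one] at htot
    exact ⟨by rw [hs, htot], hGQ.subset hp⟩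
  · exact Or.inr ⟨0, c, x, G₁, le_rfl, one_pos, hG₁.convex hG, hGQ.trans hG₁.isExtreme, hpG₁,
      h.mono hc, by simp, Or.inl rfl⟩
  · obtain ⟨t, c₁, y, ht0, ht1, h₁, hsupp, hcc⟩ := h.exists_join
      (nonempty_of_mem_pulling hT l ρ hρ) (fun h => hpG₁ (subset_of_mem_pulling l ρ hρ h)) hc hρ
    exact Or.inr ⟨t, c₁, y, G₁, ht0.le, ht1, hG₁.convex hG, hGQ.trans hG₁.isExtreme, hpG₁, h₁,
      hcc, Or.inr (hGQ.subset hp)⟩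

/-- Barycentric coordinates in pulling triangulations are unique, even across different faces of
the polytope. -/
theorem pulling_unique (hT : Triangulates T F) (l : List E) {G' : Set E}
    {c' : E →₀ ℝ} (hG : Convex ℝ G) (hGQ : IsExtreme ℝ Q G) (hG' : Convex ℝ G')
    (hGQ' : IsExtreme ℝ Q G') (h : IsRep (pulling T l G) c x) (h' : IsRep (pulling T l G') c' x) :
    c = c' := by
  induction l generalizing G G' c c' x with
  | nil => exact hT.unique _ _ _ (h.mono h.support_mem.1) (h'.mono h'.support_mem.1)
  | cons p l ih =>
    -- If `y` were closer to `p` than `y'` on their common ray, it would lie between `p` and `y'`.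
    have key : ∀ {t t' : ℝ} {y y' G₁}, t' < 1 → IsExtreme ℝ Q G₁ → p ∉ G₁ → y ∈ G₁ → y' ∈ Q →
        (t' = 0 ∨ p ∈ Q) → 0 ≤ t → t • p + (1 - t) • y = t' • p + (1 - t') • y' → t' ≤ t := by
      intro t t' y y' G₁ ht' hG₁ hp hy hy' hpQ ht hxy
      by_contra! hlt
      have hpQ : p ∈ Q := hpQ.resolve_left (by linarith)
      have h1 : 0 < 1 - t := by linarith
      refine hp (hG₁.left_mem_of_mem_openSegment hpQ hy' hy ⟨(t' - t) / (1 - t),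
        (1 - t') / (1 - t), div_pos (by linarith) h1, div_pos (by linarith) h1,
        by field_simp; ring, ?_⟩)
      have hy2 : (1 - t) • y = (t' - t) • p + (1 - t') • y' := by
        rw [← add_right_inj (t • p), hxy]
        module
      refine smul_right_injective E h1.ne' ?_
      simp only
      rw [hy2]
      match_scalars <;> field_simp
    have hmem : ∀ {c₁ y G₁}, Convex ℝ G₁ → IsRep (pulling T l G₁) c₁ y → y ∈ G₁ :=
      fun hG₁ h₁ => h₁.mem hG₁ (subset_of_mem_pulling l _ h₁.support_mem)
    have hx := h.bary.trans h'.bary.symm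
    rcases h.of_pulling hT.nonempty l hG hGQ with
        ⟨rfl, hpQ⟩ | ⟨t, c₁, y, G₁, ht0, ht1, hG₁, hGQ₁, hp₁, h₁, rfl, hpQ⟩ <;>
      rcases h'.of_pulling hT.nonempty l hG' hGQ' with
        ⟨rfl, hpQ'⟩ | ⟨t', c₂, y', G₂, ht0', ht1', hG₂, hGQ₂, hp₂, h₂, rfl, hpQ'⟩ <;>
      simp only [map_add, map_smul, Finsupp.linearCombination_single, id, one_smul] at hx
    · rfl
    · rw [h₂.bary] at hx
      have : y' = p := eq_of_join_eq ht1' (by rw [← hx]; module)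
      exact (hp₂ (this ▸ hmem hG₂ h₂)).elim
    · rw [h₁.bary] at hx
      have : y = p := eq_of_join_eq ht1 (by rw [hx]; module)
      exact (hp₁ (this ▸ hmem hG₁ h₁)).elim
    · rw [h₁.bary, h₂.bary] at hx
      have hy := hmem hG₁ h₁
      have hy' := hmem hG₂ h₂
      obtain rfl := le_antisymm
        (key ht1 hGQ₂ hp₂ hy' (hGQ₁.subset hy) hpQ ht0' hx.symm)
        (key ht1' hGQ₁ hp₁ hy (hGQ₂.subset hy') hpQ' ht0 hx)
      obtain rfl := eq_of_join_eq ht1 hx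
      rw [ih hG₁ hGQ₁ hG₂ hGQ₂ h₁ h₂]

theorem exists_isRep_pulling [IsTopologicalAddGroup E] [ContinuousSMul ℝ E] [T2Space E]
    [FiniteDimensional ℝ E] (hA : A.Finite) (hT : Triangulates T F) (hF : Convex ℝ F)
    (l : List E) (hG : Convex ℝ G) (hGA : IsExtreme ℝ (convexHull ℝ A) G)
    (hl : ∀ a ∈ A, a ∈ G → a ∈ l ∨ a ∈ F) (hFA : F ⊆ convexHull ℝ A) (hx : x ∈ G) :
    ∃ c, IsRep (pulling T l G) c x := by
  induction l generalizing G x with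
  | nil =>
    have hGF : G ⊆ F := fun y hy => convexHull_min
      (fun a ha => (hl a ha.1 ha.2).resolve_left List.not_mem_nil) hF
      (subset_convexHull_inter_of_isExtreme hGA hy)
    obtain ⟨c, hc⟩ := hT.exists_rep x (hGF hx)
    exact ⟨c, hc.mono ⟨hc.support_mem, hc.support_subset (convex_convexHull ℝ A) hGA
      ((hT.subset _ hc.support_mem).trans hFA) hx⟩⟩
  | cons p l ih =>
    by_cases hp : p ∈ G
    · rcases eq_or_ne x p with rfl | hxp
      · exact ⟨_, isRep_single (Or.inr ⟨hp, Or.inl (Finset.coe_singleton x)⟩)⟩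
      have hGeq : G = convexHull ℝ (A ∩ G) := Set.Subset.antisymm
        (subset_convexHull_inter_of_isExtreme hGA) (convexHull_min Set.inter_subset_right hG)
      obtain ⟨t, y, G₁, ht0, ht1, hG₁, hp₁, hy, rfl⟩ := exists_face_of_ray
        (hA.subset Set.inter_subset_left) (hGeq ▸ hx) hxp
      rw [← hGeq] at hG₁
      obtain ⟨c, hc⟩ := ih (hG₁.convex hG) (hGA.trans hG₁.isExtreme) (fun a ha ha₁ => by
        rcases hl a ha (hG₁.subset ha₁) with h | h
        · exact Or.inl ((List.mem_cons.1 h).resolve_left fun h => hp₁ (h ▸ ha₁))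
        · exact Or.inr h) hy
      rcases ht0.eq_or_lt with rfl | ht0
      · refine ⟨c, ?_⟩
        rw [zero_smul, zero_add, sub_zero, one_smul]
        exact hc.mono (Or.inr ⟨hp, Or.inr ⟨G₁, hG₁, hp₁, Or.inl hc.support_mem⟩⟩)
      · refine ⟨_, hc.join (T' := BirkhoffFour.pulling T (p :: l) G) (t := t) (p := p) (fun h => hp₁ (subset_of_mem_pulling l _ hc.support_mem h)) ht0 ht1 fun τ hτ => ?_⟩
        exact Or.inr ⟨hp, Or.inr ⟨G₁, hG₁, hp₁, Or.inr ⟨_, hc.support_mem, hτ⟩⟩⟩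
    · obtain ⟨c, hc⟩ := ih hG hGA (fun a ha haG => (hl a ha haG).imp_left fun h =>
        (List.mem_cons.1 h).resolve_left (ne_of_mem_of_not_mem haG hp)) hx
      exact ⟨c, hc.mono (Or.inl ⟨hp, hc.support_mem⟩)⟩

/-- Pulling the vertices of a polytope outside a face `F`, and then subdividing the faces of `F`
by a triangulation of `F`, yields a triangulation. -/
theorem Triangulates.pulling [IsTopologicalAddGroup E] [ContinuousSMul ℝ E] [T2Space E]
    [FiniteDimensional ℝ E] (hA : A.Finite) (hT : Triangulates T F) (hF : Convex ℝ F)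
    (hFA : F ⊆ convexHull ℝ A) (l : List E) (hl : ∀ a ∈ A, a ∈ l ∨ a ∈ F) :
    Triangulates (pulling T l (convexHull ℝ A)) (convexHull ℝ A) :=
  ⟨nonempty_of_mem_pulling hT.nonempty l, pulling_down_closed hT.down_closed l,
    subset_of_mem_pulling l,
    fun _ hx => exists_isRep_pulling hA hT hF l (convex_convexHull ℝ A) IsExtreme.rfl
      (fun a ha _ => hl a ha) hFA hx,
    fun _ _ _ h h' => pulling_unique hT l (convex_convexHull ℝ A)
      IsExtreme.rfl (convex_convexHull ℝ A) IsExtreme.rfl h h'⟩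

theorem mem_of_mem_pulling {V : Set E} (hT : ∀ τ ∈ T, (τ : Set E) ⊆ V) {l : List E}
    (hl : ∀ v ∈ l, v ∈ V) : ∀ τ ∈ pulling T l P, (τ : Set E) ⊆ V := by
  induction l generalizing P with
  | nil => exact fun τ hτ => hT τ hτ.1
  | cons p l ih =>
    have ih := fun P => ih (P := P) fun v hv => hl v (by simp [hv])
    have hp := hl p (by simp)
    rintro τ (⟨-, hτ⟩ | ⟨-, hτ | ⟨G, hG, -, hτ | ⟨ρ, hρ, hτ⟩⟩⟩)
    · exact ih _ τ hτ
    · rw [hτ]; exact Set.singleton_subset_iff.2 hp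
    · exact ih _ τ hτ
    · rw [hτ]; exact Set.insert_subset hp (ih _ ρ hρ)

theorem mem_of_mem_pulling_of_subset {l : List E} (hl : ∀ v ∈ l, v ∉ F) :
    ∀ τ ∈ pulling T l P, (τ : Set E) ⊆ F → τ ∈ T := by
  induction l generalizing P with
  | nil => exact fun τ hτ _ => hτ.1
  | cons p l ih =>
    have ih := fun P => ih (P := P) fun v hv => hl v (by simp [hv])
    have hp := hl p (by simp)
    rintro τ (⟨-, hτ⟩ | ⟨-, hτ | ⟨G, hG, -, hτ | ⟨ρ, hρ, hτ⟩⟩⟩) hF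
    · exact ih _ τ hτ hF
    · exact (hp (hF (by rw [hτ]; rfl))).elim
    · exact ih _ τ hτ hF
    · exact (hp (hF (by rw [hτ]; exact Set.mem_insert _ _))).elim

theorem mem_pulling_of_mem (hF : IsExposed ℝ Q F) {l : List E} (hl : ∀ v ∈ l, v ∉ F)
    (hPQ : P ⊆ Q) {τ : Finset E} (hτ : τ ∈ T) (hτF : (τ : Set E) ⊆ F) (hτP : (τ : Set E) ⊆ P) :
    τ ∈ pulling T l P := by
  induction l generalizing P with
  | nil => exact ⟨hτ, hτP⟩
  | cons p l ih =>
    have ih := fun {P} => ih (P := P) fun v hv => hl v (by simp [hv])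
    by_cases hp : p ∈ P
    · refine Or.inr ⟨hp, Or.inr ⟨P ∩ F, ?_, fun h => hl p (by simp) h.2, Or.inl
        (ih (Set.inter_subset_left.trans hPQ) (Set.subset_inter hτP hτF))⟩⟩
      rintro ⟨z, hzP, hzF⟩
      obtain ⟨f, rfl⟩ := hF ⟨z, hzF⟩
      exact ⟨f, Set.ext fun x => ⟨fun hx => ⟨hx.1, fun y hy => hx.2.2 y (hPQ hy)⟩,
        fun hx => ⟨hx.1, hPQ hx.1, fun y hy => (hzF.2 y hy).trans (hx.2 z hzP)⟩⟩⟩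
    · exact Or.inl ⟨hp, ih hPQ hτP⟩

end Pulling

/-! ### Regular triangulations -/

section Regular

variable {E : Type*} [AddCommGroup E] [Module ℝ E]

/-- If a triangulation of points in convex position is regular, then for each of its simplices some
affine function touches the lifting from below exactly at the vertices of the simplex. -/
theorem IsRegularTriangulation.exists_lifting {A : Set E} {T : Set (Finset E)}
    (hA : ∀ a ∈ A, a ∉ convexHull ℝ (A \ {a})) (hTA : ∀ τ ∈ T, (τ : Set E) ⊆ A)
    (h : IsRegularTriangulation A T) :
    ∃ w : E → ℝ, ∀ τ ∈ T, ∃ (φ : E →ₗ[ℝ] ℝ) (d : ℝ),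
      ∀ a ∈ A, d ≤ φ a + w a ∧ (φ a + w a = d ↔ a ∈ τ) := by
  obtain ⟨w, hw⟩ := h
  refine ⟨w, fun τ hτ => ?_⟩
  have hτ' : convexHull ℝ (τ : Set E) ∈
      (fun G : Set (E × ℝ) => Prod.fst '' G) '' lowerFaces A w := hw ▸ ⟨τ, hτ, rfl⟩
  obtain ⟨G, ⟨⟨z₀, hz₀⟩, φ, hG⟩, hGτ⟩ := hτ'
  have hvert : ∀ {B : Set E} {a : E}, a ∈ A → B ⊆ A → a ∈ convexHull ℝ B → a ∈ B := by
    intro B a ha hB hab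
    by_contra haB
    have hBa : B ⊆ A \ {a} := fun b hb => ⟨hB hb, fun h => haB (Set.mem_singleton_iff.1 h ▸ hb)⟩
    exact hA a ha (convexHull_mono hBa hab)
  let ψ : E × ℝ →ₗ[ℝ] ℝ := φ.coprod LinearMap.id
  have hψ : ∀ z, ψ z = φ z.1 + z.2 := fun z => by simp [ψ]
  have hlift : ∀ a ∈ A, (a, w a) ∈ liftedPolytope A w :=
    fun a ha => subset_convexHull ℝ _ ⟨a, ha, rfl⟩
  have hmin : ∀ z ∈ liftedPolytope A w, ψ z₀ ≤ ψ z := fun z hz => by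
    rw [hψ, hψ]
    rw [hG] at hz₀
    exact hz₀.2 z hz
  have hGmem : ∀ z, z ∈ G ↔ z ∈ liftedPolytope A w ∧ ψ z = ψ z₀ := fun z => by
    rw [hG] at hz₀ ⊢
    refine and_congr_right fun hz => ⟨fun h => ?_, fun h y hy => ?_⟩
    · refine le_antisymm ?_ (hmin z hz)
      rw [hψ, hψ]
      exact h z₀ hz₀.1
    · rw [← hψ, ← hψ, h]
      exact hmin y hy
  have hext : IsExtreme ℝ (liftedPolytope A w) G := by
    refine ⟨fun z hz => ((hGmem z).1 hz).1, ?_⟩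
    rintro u hu v hv z hz ⟨r, s, hr, hs, hrs, rfl⟩
    refine (hGmem u).2 ⟨hu, le_antisymm ?_ (hmin u hu)⟩
    have h1 := ((hGmem _).1 hz).2
    rw [map_add, map_smul, map_smul, smul_eq_mul, smul_eq_mul] at h1
    have h2 := hmin v hv
    obtain rfl : s = 1 - r := by linarith
    nlinarith
  refine ⟨φ, ψ z₀, fun a ha => ⟨?_, fun h => ?_, fun h => ?_⟩⟩
  · have := hmin _ (hlift a ha)
    rwa [hψ (a, w a)] at this
  · refine hvert ha (hTA τ hτ) ?_
    rw [← hGτ]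
    exact ⟨(a, w a), (hGmem _).2 ⟨hlift a ha, by rw [hψ (a, w a), h]⟩, rfl⟩
  · -- `a` is the projection of a convex combination of lifted points in the face, hence it is
    -- one of these points.
    have hmem : a ∈ convexHull ℝ (τ : Set E) := subset_convexHull ℝ _ h
    rw [← hGτ] at hmem
    obtain ⟨z, hz, rfl⟩ := hmem
    have h1 := Set.mem_image_of_mem (LinearMap.fst ℝ E ℝ)
      (subset_convexHull_inter_of_isExtreme hext hz)
    rw [LinearMap.image_convexHull] at h1
    have h2 := hvert ha (by rintro _ ⟨_, ⟨⟨b, hb, rfl⟩, -⟩, rfl⟩; exact hb) h1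
    obtain ⟨_, ⟨⟨b, hb, rfl⟩, hbG⟩, hbz⟩ := h2
    have := ((hGmem _).1 hbG).2
    rw [hψ] at this
    simpa [← hbz] using this

end Regular

/-! ### The walls of the triangulation -/

/-- The words of the fourteen permutation matrices `X z`. -/
def word : Label → Fin 4 → Fin 4
  | .a => ![1, 3, 2, 0]
  | .b => ![1, 2, 3, 0]
  | .c => ![1, 3, 0, 2]
  | .d => ![1, 0, 3, 2]
  | .e => ![2, 3, 1, 0]
  | .f => ![2, 3, 0, 1]
  | .g => ![2, 1, 3, 0]
  | .h => ![2, 0, 3, 1]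
  | .i => ![3, 2, 1, 0]
  | .j => ![3, 2, 0, 1]
  | .k => ![3, 1, 0, 2]
  | .l => ![3, 1, 2, 0]
  | .m => ![3, 0, 1, 2]
  | .n => ![3, 0, 2, 1]

theorem X_apply (z : Label) (p q : Fin 4) : X z p q = if word z p = q then 1 else 0 := by
  cases z <;> fin_cases p <;> fin_cases q <;> simp [X, word]

/-- The walls: the affine functions on `F` whose zero sets are the hyperplanes spanned by the
interior facets of the triangulation. Such a function is given by two lists of labels: it maps the
affine combination of the fourteen points with coefficients `c` to the sum of `c` over the first
list minus the sum of `c` over the second list. -/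
def wallLabels : Fin 29 → List Label × List Label :=
  ![
    ([.e, .g], [.j, .n]),
    ([.b, .g], [.m, .n]),
    ([.c, .e, .f], [.l, .n]),
    ([.b, .c, .d], [.l, .n]),
    ([.b, .j], [.e, .m]),
    ([.c], [.g, .h, .l, .n]),
    ([.b, .d], [.e, .f]),
    ([.c, .f, .j], [.g, .l]),
    ([.c, .d, .m], [.g, .l]),
    ([.b, .c], [.h, .l, .m, .n, .n]),
    ([.b, .e, .g, .g, .h, .i, .l], [.c]),
    ([.e], [.j, .k, .l, .n]),
    ([.d, .m], [.f, .j]),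
    ([.c, .e], [.h, .j, .l, .n, .n]),
    ([.b, .c, .d, .j], [.e, .g, .l]),
    ([.b, .c, .f, .j], [.l, .m, .n]),
    ([.b, .g, .l], [.c, .e, .f, .m]),
    ([.b, .e, .g, .i], [.n]),
    ([.b, .c, .d, .g, .k], [.n]),
    ([.a, .c, .f, .j, .n], [.g]),
    ([.c, .d, .e, .m], [.j, .l, .n]),
    ([.b], [.k, .l, .m, .n]),
    ([.b, .d, .g], [.f, .j, .n]),
    ([.a, .b, .c, .f, .j], [.m]),
    ([.d, .m, .n], [.e, .f, .g]),
    ([.b, .c, .d, .j, .k], [.e]),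
    ([.c, .d], [.e, .g, .i, .l]),
    ([.c, .k], [.h, .n]),
    ([.b, .g, .i, .l], [.c, .f])]

/-- The value of a wall function at an affine combination of the points `X z`. -/
def wall (c : Label → ℝ) (k : Fin 29) : ℝ :=
  ((wallLabels k).1.map c).sum - ((wallLabels k).2.map c).sum

/-- The value of a wall function at a point `X z`. -/
def wallValue (k : Fin 29) (z : Label) : ℤ :=
  (wallLabels k).1.count z - (wallLabels k).2.count z

/-- The wall functions that are nonnegative on a simplex and vanish on one of its facets. -/
def above : Fin 32 → List (Fin 29) :=
  ![
    [11, 21, 27], [11, 21], [1, 9], [1, 3, 15], [1], [1, 12, 23], [1, 4], [0, 5], [0, 3, 7],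
    [5, 17], [2, 3, 17], [0, 18], [], [0, 19, 22], [], [10, 26], [], [25], [6], [8, 14],
    [6, 7, 28], [4], [1, 5], [0, 4, 13], [2, 3], [6], [1, 2, 8], [0, 2, 4, 20], [0, 4, 12],
    [6, 24], [4, 12], [7, 8, 16]]

/-- The wall functions that are nonpositive on a simplex and vanish on one of its facets. -/
def below : Fin 32 → List (Fin 29) :=
  ![
    [], [27], [4, 21], [4, 9, 21], [3, 4, 12], [4, 15], [3, 6], [1], [1, 5], [0, 1], [0, 1, 5],
    [1, 3, 22], [19, 23], [1, 7], [10, 17], [17, 28], [18, 25], [0, 4, 6, 14], [0, 4, 7],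
    [3, 6, 26], [2, 16], [1, 6, 8], [0], [11], [8, 20], [2, 12, 24], [0, 5], [11, 13], [2],
    [8, 12], [0, 7], [2]]

/-- The hyperplane spanned by a facet of a simplex is the zero set of one of its wall functions or
of a matrix entry. The function takes the value one at the opposite vertex. -/
theorem exists_facet_function : ∀ i, ∀ z ∈ simplex i,
    (∃ k ∈ above i, ∀ z' ∈ simplex i, wallValue k z' = if z' = z then 1 else 0) ∨
    (∃ k ∈ below i, ∀ z' ∈ simplex i, wallValue k z' = if z' = z then -1 else 0) ∨
    ∃ p q, ∀ z' ∈ simplex i, word z' p = q ↔ z' = z := by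
  decide +kernel

/-- For any two simplices, every vertex of the first that is not a vertex of the second lies off a
wall that weakly separates the two simplices. -/
theorem exists_separating_wall : ∀ i j, ∀ z ∈ simplex i, z ∉ simplex j →
    ∃ k, wallValue k z ≠ 0 ∧
      ((∀ z' ∈ simplex i, 0 ≤ wallValue k z') ∧ (∀ z' ∈ simplex j, wallValue k z' ≤ 0) ∨
        (∀ z' ∈ simplex i, wallValue k z' ≤ 0) ∧ (∀ z' ∈ simplex j, 0 ≤ wallValue k z')) := by
  decide +kernel

/-! ### The Gale transform -/

theorem sum_label {M : Type*} [AddCommMonoid M] (f : Label → M) :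
    ∑ z, f z = f .a + f .b + f .c + f .d + f .e + f .f + f .g + f .h + f .i + f .j + f .k +
      f .l + f .m + f .n := by
  have : (Finset.univ : Finset Label) = {.a, .b, .c, .d, .e, .f, .g, .h, .i, .j, .k, .l, .m, .n} :=
    rfl
  rw [this]
  repeat rw [Finset.sum_insert (by decide)]
  rw [Finset.sum_singleton]
  simp only [add_assoc]

/-- The linear dependence of the points `(1, X z)` with coefficients `Y z ⬝ᵥ y`. -/
def gale : (Fin 6 → ℝ) →ₗ[ℝ] Label → ℝ := (Matrix.of Y).mulVecLin

theorem gale_apply (y : Fin 6 → ℝ) (z : Label) : gale y z = Y z ⬝ᵥ y := rfl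

theorem gale_values (y : Fin 6 → ℝ) :
    gale y .h = y 0 ∧ gale y .j = y 1 ∧ gale y .k = y 2 ∧ gale y .l = y 3 ∧ gale y .m = y 4 ∧
      gale y .n = y 5 := by
  simp [gale_apply, Y, dotProduct, Fin.sum_univ_succ]

theorem gale_injective : Function.Injective gale := by
  rw [← LinearMap.ker_eq_bot, LinearMap.ker_eq_bot']
  intro y hy
  obtain ⟨h0, h1, h2, h3, h4, h5⟩ := gale_values y
  simp only [hy, Pi.zero_apply] at h0 h1 h2 h3 h4 h5
  ext s
  fin_cases s <;> simp [← h0, ← h1, ← h2, ← h3, ← h4, ← h5]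

theorem sum_gale_smul_X (y : Fin 6 → ℝ) : ∑ z, gale y z • X z = 0 := by
  ext p q
  rw [Matrix.sum_apply, sum_label]
  fin_cases p <;> fin_cases q <;>
    simp [gale_apply, X, Y, dotProduct, Fin.sum_univ_succ] <;> ring

theorem sum_gale (y : Fin 6 → ℝ) : ∑ z, gale y z = 0 := by
  rw [sum_label]
  simp [gale_apply, Y, dotProduct, Fin.sum_univ_succ]
  ring

/-- Every affine dependence of the points `X z` comes from the Gale transform, because the columns
`Y h`, `Y j`, `Y k`, `Y l`, `Y m`, `Y n` are the unit vectors. -/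
theorem exists_gale_eq {c : Label → ℝ} (h1 : ∑ z, c z = 0) (hX : ∑ z, c z • X z = 0) :
    ∃ y, gale y = c := by
  refine ⟨![c .h, c .j, c .k, c .l, c .m, c .n], ?_⟩
  have hX' : ∀ p q, ∑ z, c z * X z p q = 0 := fun p q => by
    have := congrFun (congrFun hX p) q
    rwa [Matrix.sum_apply] at this
  rw [sum_label] at h1
  have h01 := hX' 0 1
  have h02 := hX' 0 2
  have h03 := hX' 0 3
  have h10 := hX' 1 0
  have h11 := hX' 1 1
  have h12 := hX' 1 2
  have h13 := hX' 1 3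
  have h20 := hX' 2 0
  have h21 := hX' 2 1
  have h22 := hX' 2 2
  have h23 := hX' 2 3
  have h30 := hX' 3 0
  have h31 := hX' 3 1
  have h32 := hX' 3 2
  simp [sum_label, X] at h01 h02 h03 h10 h11 h12 h13 h20 h21 h22 h23 h30 h31 h32
  ext z
  cases z <;> simp [gale_apply, Y, dotProduct, Fin.sum_univ_succ] <;> linarith

theorem isGaleTransform_Y : IsGaleTransform homogenization Y := by
  have hrow : ∀ s, (fun z => Y z s) = gale (Pi.single s 1) := fun s => by
    ext z
    rw [gale_apply, dotProduct_single, mul_one]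
  have hfun : (fun (s : Fin 6) (z : Label) => Y z s) = fun s => gale (Pi.basisFun ℝ (Fin 6) s) := by
    ext s z
    rw [Pi.basisFun_apply, ← hrow]
  constructor
  · rw [hfun]
    exact (Pi.basisFun ℝ (Fin 6)).linearIndependent.map' gale
      (LinearMap.ker_eq_bot.2 gale_injective)
  · rw [hfun, show (fun s => gale (Pi.basisFun ℝ (Fin 6) s)) = gale ∘ Pi.basisFun ℝ (Fin 6) from rfl,
      Set.range_comp, Submodule.span_image, (Pi.basisFun ℝ (Fin 6)).span_eq, Submodule.map_top]
    ext c
    constructor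
    · rintro ⟨y, rfl⟩ (_ | ⟨p, q⟩)
      · simpa [homogenization] using sum_gale y
      · have := congrFun (congrFun (sum_gale_smul_X y) p) q
        rwa [Matrix.sum_apply] at this
    · intro h
      obtain ⟨y, rfl⟩ := exists_gale_eq (c := c) (by simpa [homogenization] using h none) (by
        ext p q
        rw [Matrix.sum_apply]
        exact h (some (p, q)))
      exact ⟨y, rfl⟩

/-! ### Coordinates in the simplices -/

theorem sum_map_eq_sum_count (l : List Label) (c : Label → ℝ) :
    (l.map c).sum = ∑ z, c z * (l.count z : ℤ) := by
  rw [Finset.sum_list_map_count, Finset.sum_subset (Finset.subset_univ _)]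
  · exact Finset.sum_congr rfl fun z _ => by rw [nsmul_eq_mul, mul_comm, Int.cast_natCast]
  · intro z _ hz
    rw [List.mem_toFinset] at hz
    rw [List.count_eq_zero_of_not_mem hz, zero_nsmul]

theorem wall_eq_sum (c : Label → ℝ) (k : Fin 29) : wall c k = ∑ z, c z * wallValue k z := by
  simp only [wall, wallValue, sum_map_eq_sum_count, Int.cast_sub, mul_sub,
    Finset.sum_sub_distrib]

/-- The wall functions are affine functions on `F`: they vanish on affine dependences. -/
theorem wall_gale (y : Fin 6 → ℝ) (k : Fin 29) : wall (gale y) k = 0 := by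
  fin_cases k <;> simp [wall, wallLabels, gale_apply, Y, dotProduct, Fin.sum_univ_succ] <;> ring

theorem wall_sub (c c' : Label → ℝ) (k : Fin 29) : wall (c - c') k = wall c k - wall c' k := by
  simp only [wall_eq_sum, Pi.sub_apply, sub_mul, Finset.sum_sub_distrib]

theorem wall_of_support {i : Fin 32} {k : Fin 29} {z : Label} (hz : z ∈ simplex i) {r : ℤ}
    (hk : ∀ z' ∈ simplex i, wallValue k z' = if z' = z then r else 0) {c : Label → ℝ}
    (hc : ∀ z ∉ simplex i, c z = 0) : wall c k = c z * r := by
  rw [wall_eq_sum, Finset.sum_eq_single z]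
  · rw [hk z hz, if_pos rfl]
  · intro z' _ hne
    by_cases hz' : z' ∈ simplex i
    · rw [hk z' hz', if_neg hne, Int.cast_zero, mul_zero]
    · rw [hc z' hz', zero_mul]
  · simp

/-- The signs of the wall functions at the point with coefficients `c` allow it to lie in the
simplex `i`. -/
def InChamber (i : Fin 32) (c : Label → ℝ) : Prop :=
  (∀ k ∈ above i, 0 ≤ wall c k) ∧ ∀ k ∈ below i, wall c k ≤ 0

/-- Every barycentric coordinate of a simplex is a wall function, up to sign, or a matrix entry. -/
theorem exists_coordinate {i : Fin 32} {z : Label} (hz : z ∈ simplex i) :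
    ∃ g : (Label → ℝ) → ℝ, (∀ c c', g (c - c') = g c - g c') ∧ (∀ y, g (gale y) = 0) ∧
      (∀ c : Label → ℝ, (∀ z ∉ simplex i, c z = 0) → g c = c z) ∧
      ∀ c : Label → ℝ, (∀ z, 0 ≤ c z) → InChamber i c → 0 ≤ g c := by
  rcases exists_facet_function i z hz with ⟨k, hk, h⟩ | ⟨k, hk, h⟩ | ⟨p, q, h⟩
  · refine ⟨fun c => wall c k, fun c c' => wall_sub c c' k, fun y => wall_gale y k,
      fun c hc => ?_, fun c _ hc => hc.1 k hk⟩
    simpa using wall_of_support hz h hc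
  · refine ⟨fun c => -wall c k, fun c c' => by simp only [wall_sub]; ring,
      fun y => by simp [wall_gale], fun c hc => ?_, fun c _ hc => by
        simpa using hc.2 k hk⟩
    simp [wall_of_support hz h hc]
  · refine ⟨fun c => ∑ z, c z * X z p q, fun c c' => ?_, fun y => ?_, fun c hc => ?_,
      fun c hc _ => Finset.sum_nonneg fun z _ => mul_nonneg (hc z) ?_⟩
    · simp only [Pi.sub_apply, sub_mul, Finset.sum_sub_distrib]
    · have := congrFun (congrFun (sum_gale_smul_X y) p) q
      rwa [Matrix.sum_apply] at this
    · refine (Finset.sum_eq_single z (fun z' _ hne => ?_) (by simp)).trans ?_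
      · by_cases hz' : z' ∈ simplex i
        · rw [X_apply, if_neg (fun h' => hne ((h z' hz').1 h')), mul_zero]
        · rw [hc z' hz', zero_mul]
      · rw [X_apply, if_pos ((h z hz).2 rfl), mul_one]
    · rw [X_apply]
      split <;> norm_num

/-- The vertices of each simplex are affinely independent: no nonzero affine dependence is
supported on them. -/
theorem eq_zero_of_gale_support {i : Fin 32} {y : Fin 6 → ℝ} (h : ∀ z ∉ simplex i, gale y z = 0) :
    y = 0 := by
  refine gale_injective ?_
  rw [map_zero]
  ext z
  by_cases hz : z ∈ simplex i
  · obtain ⟨g, -, hg, hgc, -⟩ := exists_coordinate hz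
    rw [← hgc _ h, hg, Pi.zero_apply]
  · exact h z hz

theorem card_simplex (i : Fin 32) : (simplex i).card = 8 := by
  revert i
  decide

theorem simplex_injective : Function.Injective simplex := by
  decide +kernel

theorem card_compl_simplex (i : Fin 32) : Fintype.card {z // z ∉ simplex i} = 6 := by
  rw [Fintype.card_subtype_compl, Fintype.card_coe, card_simplex]
  rfl

/-- Every coefficient vector can be changed by an affine dependence to one that is supported on the
simplex `i`. -/
theorem exists_gale_eq_on_compl (i : Fin 32) (c : {z // z ∉ simplex i} → ℝ) :
    ∃ y, ∀ z : {z // z ∉ simplex i}, gale y z = c z := by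
  let f : (Fin 6 → ℝ) →ₗ[ℝ] ({z // z ∉ simplex i} → ℝ) :=
    (LinearMap.funLeft ℝ ℝ Subtype.val).comp gale
  have hf : Function.Injective f := by
    rw [← LinearMap.ker_eq_bot, LinearMap.ker_eq_bot']
    exact fun y hy => eq_zero_of_gale_support fun z hz => congrFun hy ⟨z, hz⟩
  have hdim : Module.finrank ℝ (Fin 6 → ℝ) = Module.finrank ℝ ({z // z ∉ simplex i} → ℝ) := by
    rw [Module.finrank_fintype_fun_eq_card, Module.finrank_fintype_fun_eq_card,
      card_compl_simplex, Fintype.card_fin]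
  obtain ⟨y, hy⟩ := (LinearMap.injective_iff_surjective_of_finrank_eq_finrank hdim).1 hf c
  exact ⟨y, fun z => congrFun hy z⟩

theorem linearIndependent_Y (i : Fin 32) :
    LinearIndependent ℝ (fun z : {z // z ∉ simplex i} => Y z) := by
  rw [Fintype.linearIndependent_iff]
  intro a ha z
  obtain ⟨y, hy⟩ := exists_gale_eq_on_compl i (Pi.single z 1)
  -- `y` is the element of the dual basis that picks out the coefficient `a z`.
  have := congrArg (· ⬝ᵥ y) ha
  simp only [sum_dotProduct, smul_dotProduct, ← gale_apply, hy, zero_dotProduct] at this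
  simpa [Pi.single_apply] using this

/-! ### Every point of `F` has unique coordinates in the simplices -/

theorem of_sign {P : Prop} (x : ℝ) (h₁ : 0 ≤ x → P) (h₂ : x ≤ 0 → P) : P :=
  (le_total 0 x).elim h₁ h₂

/-- The chambers cover `F`: a decision tree on the signs of the wall functions finds, for a convex
combination of the points `X z`, a simplex whose wall functions all have the right sign. -/
theorem exists_inChamber {c : Label → ℝ} (hc : ∀ z, 0 ≤ c z) : ∃ i, InChamber i c := by
  have ha := hc .a
  have hb := hc .b
  have hc' := hc .c
  have hd := hc .d
  have he := hc .e
  have hf := hc .f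
  have hg := hc .g
  have hh := hc .h
  have hi := hc .i
  have hj := hc .j
  have hk := hc .k
  have hl := hc .l
  have hm := hc .m
  have hn := hc .n
  clear hc
  refine of_sign (wall c 1)
    (fun _ => of_sign (wall c 23)
      (fun _ => of_sign (wall c 4)
        (fun _ => of_sign (wall c 11)
          (fun _ => of_sign (wall c 27)
            (fun _ => ⟨0, ?_⟩)
            (fun _ => ⟨1, ?_⟩))
          (fun _ => of_sign (wall c 2)
            (fun _ => of_sign (wall c 3)
              (fun _ => of_sign (wall c 0)
                (fun _ => of_sign (wall c 13)
                  (fun _ => ⟨23, ?_⟩)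
                  (fun _ => of_sign (wall c 20)
                    (fun _ => ⟨27, ?_⟩)
                    (fun _ => ⟨24, ?_⟩)))
                (fun _ => of_sign (wall c 5)
                  (fun _ => ⟨22, ?_⟩)
                  (fun _ => of_sign (wall c 8)
                    (fun _ => ⟨26, ?_⟩)
                    (fun _ => ⟨24, ?_⟩))))
              (fun _ => ⟨6, ?_⟩))
            (fun _ => of_sign (wall c 6)
              (fun _ => of_sign (wall c 12)
                (fun _ => of_sign (wall c 0)
                  (fun _ => ⟨28, ?_⟩)
                  (fun _ => of_sign (wall c 7)
                    (fun _ => ⟨31, ?_⟩)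
                    (fun _ => ⟨30, ?_⟩)))
                (fun _ => of_sign (wall c 24)
                  (fun _ => of_sign (wall c 8)
                    (fun _ => ⟨31, ?_⟩)
                    (fun _ => ⟨29, ?_⟩))
                  (fun _ => ⟨25, ?_⟩)))
              (fun _ => ⟨6, ?_⟩))))
        (fun _ => of_sign (wall c 21)
          (fun _ => of_sign (wall c 27)
            (fun _ => ⟨0, ?_⟩)
            (fun _ => ⟨1, ?_⟩))
          (fun _ => of_sign (wall c 9)
            (fun _ => ⟨2, ?_⟩)
            (fun _ => of_sign (wall c 12)
              (fun _ => of_sign (wall c 15)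
                (fun _ => ⟨3, ?_⟩)
                (fun _ => ⟨5, ?_⟩))
              (fun _ => of_sign (wall c 3)
                (fun _ => ⟨3, ?_⟩)
                (fun _ => ⟨4, ?_⟩))))))
      (fun _ => ⟨12, ?_⟩))
    (fun _ => of_sign (wall c 19)
      (fun _ => of_sign (wall c 0)
        (fun _ => of_sign (wall c 5)
          (fun _ => ⟨7, ?_⟩)
          (fun _ => of_sign (wall c 18)
            (fun _ => of_sign (wall c 7)
              (fun _ => of_sign (wall c 3)
                (fun _ => ⟨8, ?_⟩)
                (fun _ => ⟨11, ?_⟩))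
              (fun _ => of_sign (wall c 22)
                (fun _ => ⟨13, ?_⟩)
                (fun _ => ⟨11, ?_⟩)))
            (fun _ => ⟨16, ?_⟩)))
        (fun _ => of_sign (wall c 25)
          (fun _ => of_sign (wall c 5)
            (fun _ => of_sign (wall c 17)
              (fun _ => ⟨9, ?_⟩)
              (fun _ => ⟨14, ?_⟩))
            (fun _ => of_sign (wall c 10)
              (fun _ => of_sign (wall c 6)
                (fun _ => of_sign (wall c 16)
                  (fun _ => of_sign (wall c 4)
                    (fun _ => of_sign (wall c 12)
                      (fun _ => of_sign (wall c 7)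
                        (fun _ => ⟨31, ?_⟩)
                        (fun _ => ⟨30, ?_⟩))
                      (fun _ => of_sign (wall c 8)
                        (fun _ => ⟨31, ?_⟩)
                        (fun _ => ⟨29, ?_⟩)))
                    (fun _ => ⟨18, ?_⟩))
                  (fun _ => of_sign (wall c 7)
                    (fun _ => of_sign (wall c 2)
                      (fun _ => of_sign (wall c 17)
                        (fun _ => ⟨10, ?_⟩)
                        (fun _ => ⟨15, ?_⟩))
                      (fun _ => of_sign (wall c 28)
                        (fun _ => ⟨20, ?_⟩)
                        (fun _ => ⟨15, ?_⟩)))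
                    (fun _ => ⟨18, ?_⟩)))
                (fun _ => of_sign (wall c 26)
                  (fun _ => of_sign (wall c 17)
                    (fun _ => ⟨10, ?_⟩)
                    (fun _ => ⟨15, ?_⟩))
                  (fun _ => of_sign (wall c 3)
                    (fun _ => ⟨10, ?_⟩)
                    (fun _ => of_sign (wall c 8)
                      (fun _ => of_sign (wall c 14)
                        (fun _ => ⟨19, ?_⟩)
                        (fun _ => ⟨17, ?_⟩))
                      (fun _ => of_sign (wall c 4)
                        (fun _ => ⟨21, ?_⟩)
                        (fun _ => ⟨17, ?_⟩))))))
              (fun _ => ⟨14, ?_⟩)))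
          (fun _ => ⟨16, ?_⟩)))
      (fun _ => ⟨12, ?_⟩))
  all_goals
    simp only [InChamber, above, below, Matrix.cons_val, List.forall_mem_cons, List.not_mem_nil,
      IsEmpty.forall_iff, implies_true, and_true]
    repeat' apply And.intro
  -- Most of the required signs have been tested on the branch; each of the others follows from
  -- tested ones and the nonnegativity of the coefficients.
  all_goals first
    | assumption
    | exact True.intro
    | (simp only [wall, wallLabels, Matrix.cons_val, List.map_cons, List.map_nil, List.sum_cons,
        List.sum_nil] at *
       linarith)

/-- Every convex combination of the points `X z` can be rewritten, by adding an affine dependence,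
as a convex combination over one of the simplices. -/
theorem exists_simplex_coeff {c : Label → ℝ} (hc : ∀ z, 0 ≤ c z) :
    ∃ i y, (∀ z, 0 ≤ (c - gale y) z) ∧ ∀ z ∉ simplex i, (c - gale y) z = 0 := by
  obtain ⟨i, hi⟩ := exists_inChamber hc
  obtain ⟨y, hy⟩ := exists_gale_eq_on_compl i fun z => c z
  have hsupp : ∀ z ∉ simplex i, (c - gale y) z = 0 := fun z hz => by
    rw [Pi.sub_apply, hy ⟨z, hz⟩, sub_self]
  refine ⟨i, y, fun z => ?_, hsupp⟩
  by_cases hz : z ∈ simplex i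
  · obtain ⟨g, hsub, hg, hgc, hnn⟩ := exists_coordinate hz
    rw [← hgc _ hsupp, hsub, hg, sub_zero]
    exact hnn c hc hi
  · exact (hsupp z hz).ge

theorem eq_zero_of_separated {s t : Finset Label} {c c' f : Label → ℝ} (hc : ∀ z, 0 ≤ c z)
    (hc' : ∀ z, 0 ≤ c' z) (hs : ∀ z ∉ s, c z = 0) (ht : ∀ z ∉ t, c' z = 0)
    (hfs : ∀ z ∈ s, 0 ≤ f z) (hft : ∀ z ∈ t, f z ≤ 0) (h : ∑ z, c z * f z = ∑ z, c' z * f z)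
    {z : Label} (hz : f z ≠ 0) : c z = 0 := by
  have h1 : ∀ z ∈ Finset.univ, 0 ≤ c z * f z := fun z _ => by
    by_cases hz : z ∈ s
    · exact mul_nonneg (hc z) (hfs z hz)
    · rw [hs z hz, zero_mul]
  have h2 : ∑ z, c' z * f z ≤ 0 := Finset.sum_nonpos fun z _ => by
    by_cases hz : z ∈ t
    · exact mul_nonpos_of_nonneg_of_nonpos (hc' z) (hft z hz)
    · rw [ht z hz, zero_mul]
  have h3 := (Finset.sum_eq_zero_iff_of_nonneg h1).1
    (le_antisymm (h.le.trans h2) (Finset.sum_nonneg h1)) z (Finset.mem_univ z)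
  exact (mul_eq_zero.1 h3).resolve_right hz

/-- Two convex combinations over simplices with the same value agree. A wall that separates the
simplices kills the coefficients outside their common face. -/
theorem coeff_unique {i j : Fin 32} {c c' : Label → ℝ} (hc : ∀ z, 0 ≤ c z) (hc' : ∀ z, 0 ≤ c' z)
    (hi : ∀ z ∉ simplex i, c z = 0) (hj : ∀ z ∉ simplex j, c' z = 0) {y : Fin 6 → ℝ}
    (hy : gale y = c - c') : c = c' := by
  have hw : ∀ k, ∑ z, c z * (wallValue k z : ℝ) = ∑ z, c' z * (wallValue k z : ℝ) := fun k => by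
    rw [← wall_eq_sum, ← wall_eq_sum, ← sub_eq_zero, ← wall_sub, ← hy, wall_gale]
  have hcj : ∀ z ∉ simplex j, c z = 0 := fun z hz => by
    by_cases hzi : z ∈ simplex i
    · obtain ⟨k, hk, ⟨h1, h2⟩ | ⟨h1, h2⟩⟩ := exists_separating_wall i j z hzi hz
      · exact eq_zero_of_separated hc hc' hi hj (f := fun z => (wallValue k z : ℝ))
          (fun z hz => Int.cast_nonneg (h1 z hz)) (fun z hz => Int.cast_nonpos.2 (h2 z hz)) (hw k)
          (Int.cast_ne_zero.2 hk)
      · refine eq_zero_of_separated hc hc' hi hj (f := fun z => -(wallValue k z : ℝ))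
          (fun z hz => neg_nonneg.2 (Int.cast_nonpos.2 (h1 z hz)))
          (fun z hz => neg_nonpos.2 (Int.cast_nonneg (h2 z hz))) ?_
          (neg_ne_zero.2 (Int.cast_ne_zero.2 hk))
        simpa only [mul_neg, Finset.sum_neg_distrib, neg_inj] using hw k
    · exact hi z hzi
  have : y = 0 := eq_zero_of_gale_support (i := j) fun z hz => by
    rw [hy, Pi.sub_apply, hcj z hz, hj z hz, sub_zero]
  rw [this, map_zero] at hy
  exact sub_eq_zero.1 hy.symm

/-! ### The Birkhoff polytope and its face -/

theorem word_injective : Function.Injective word := by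
  intro z z'
  revert z z'
  decide

theorem X_injective : Function.Injective X := by
  intro z z' h
  refine word_injective (funext fun p => ?_)
  have := congrFun (congrFun h p) (word z p)
  rw [X_apply, X_apply, if_pos rfl] at this
  by_contra hne
  rw [if_neg (Ne.symm hne)] at this
  exact one_ne_zero this

theorem exists_word_eq : ∀ σ : Equiv.Perm (Fin 4), σ 0 ≠ 0 → σ 3 ≠ 3 →
    ∃ z, ∀ p, σ p = word z p := by
  decide +kernel

theorem exists_perm_eq : ∀ z, ∃ σ : Equiv.Perm (Fin 4), ∀ p, σ p = word z p := by
  decide +kernel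

theorem permMatrix_apply_eq_ite (σ : Equiv.Perm (Fin 4)) (p q : Fin 4) :
    σ.permMatrix ℝ p q = if σ p = q then 1 else 0 := by
  simp [PEquiv.toMatrix_apply, Equiv.toPEquiv_apply]

theorem permMatrix_eq_X {σ : Equiv.Perm (Fin 4)} {z : Label} (h : ∀ p, σ p = word z p) :
    σ.permMatrix ℝ = X z := by
  ext p q
  rw [permMatrix_apply_eq_ite, X_apply, h]

theorem extremePoints_B₄ :
    B₄.extremePoints ℝ = {σ.permMatrix ℝ | σ : Equiv.Perm (Fin 4)} :=
  extremePoints_doublyStochastic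

theorem finite_extremePoints_B₄ : (B₄.extremePoints ℝ).Finite := by
  rw [extremePoints_B₄]
  exact Set.finite_range _

theorem B₄_eq_convexHull : B₄ = convexHull ℝ (B₄.extremePoints ℝ) := by
  rw [extremePoints_B₄]
  exact doublyStochastic_eq_convexHull_permMatrix

theorem convex_B₄ : Convex ℝ B₄ := by
  rw [B₄_eq_convexHull]
  exact convex_convexHull ℝ _

theorem nonneg_of_mem_B₄ {M : Matrix (Fin 4) (Fin 4) ℝ} (hM : M ∈ B₄) (p q : Fin 4) :
    0 ≤ M p q :=
  nonneg_of_mem_doublyStochastic hM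

theorem X_mem_extremePoints_B₄ (z : Label) : X z ∈ B₄.extremePoints ℝ := by
  obtain ⟨σ, hσ⟩ := exists_perm_eq z
  rw [extremePoints_B₄]
  exact ⟨σ, permMatrix_eq_X hσ⟩

theorem X_mem_F (z : Label) : X z ∈ F := by
  refine ⟨extremePoints_subset (X_mem_extremePoints_B₄ z), ?_⟩
  cases z <;> simp [X]

theorem isExposed_F : IsExposed ℝ B₄ F := by
  intro _
  let f : Matrix (Fin 4) (Fin 4) ℝ →ₗ[ℝ] ℝ :=
    -(Matrix.entryLinearMap ℝ ℝ 0 0 + Matrix.entryLinearMap ℝ ℝ 3 3)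
  have hf : ∀ M, LinearMap.toContinuousLinearMap f M = -(M 0 0 + M 3 3) := fun M => rfl
  refine ⟨LinearMap.toContinuousLinearMap f, Set.ext fun M => ?_⟩
  simp only [hf]
  constructor
  · rintro ⟨hM, h0, h3⟩
    refine ⟨hM, fun N hN => ?_⟩
    have := nonneg_of_mem_B₄ hN 0 0
    have := nonneg_of_mem_B₄ hN 3 3
    rw [h0, h3]
    linarith
  · rintro ⟨hM, h⟩
    have h1 := h (X .a) (X_mem_F .a).1
    have h2 := nonneg_of_mem_B₄ hM 0 0
    have h3 := nonneg_of_mem_B₄ hM 3 3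
    rw [(X_mem_F .a).2.1, (X_mem_F .a).2.2] at h1
    exact ⟨hM, by linarith, by linarith⟩

theorem extremePoints_F : F.extremePoints ℝ = Set.range X := by
  rw [isExposed_F.isExtreme.extremePoints_eq]
  ext M
  constructor
  · rintro ⟨hF, hM⟩
    rw [extremePoints_B₄] at hM
    obtain ⟨σ, rfl⟩ := hM
    have h0 := hF.2.1
    have h3 := hF.2.2
    rw [permMatrix_apply_eq_ite] at h0 h3
    obtain ⟨z, hz⟩ := exists_word_eq σ (fun h => by simp [h] at h0) (fun h => by simp [h] at h3)
    exact ⟨z, (permMatrix_eq_X hz).symm⟩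
  · rintro ⟨z, rfl⟩
    exact ⟨X_mem_F z, X_mem_extremePoints_B₄ z⟩

theorem convex_F : Convex ℝ F := isExposed_F.convex convex_B₄

theorem F_eq_convexHull : F = convexHull ℝ (Set.range X) := by
  refine Set.Subset.antisymm ?_ (convexHull_min (Set.range_subset_iff.2 X_mem_F) convex_F)
  have h := isExposed_F.isExtreme
  rw [B₄_eq_convexHull] at h
  refine (subset_convexHull_inter_of_isExtreme h).trans (convexHull_mono ?_)
  rw [← extremePoints_F, isExposed_F.isExtreme.extremePoints_eq, Set.inter_comm]

theorem notMem_convexHull_of_extremePoints {E : Type*} [AddCommGroup E] [Module ℝ E] {P : Set E}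
    (hP : Convex ℝ P) : ∀ a ∈ P.extremePoints ℝ, a ∉ convexHull ℝ (P.extremePoints ℝ \ {a}) :=
  fun _ ha h => (hP.mem_extremePoints_iff_mem_sdiff_convexHull_sdiff.1 ha).2
    (convexHull_mono (Set.sdiff_subset_sdiff_left extremePoints_subset) h)

/-! ### The triangulation of the face -/

open Classical in
theorem image_simplex_mem_T (i : Fin 32) : (simplex i).image X ∈ T := by
  refine ⟨?_, i, by rw [Finset.coe_image]⟩
  rw [Finset.image_nonempty, ← Finset.card_pos, card_simplex]
  norm_num

theorem subset_range_X {τ : Finset (Matrix (Fin 4) (Fin 4) ℝ)} (hτ : τ ∈ T) :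
    (τ : Set (Matrix (Fin 4) (Fin 4) ℝ)) ⊆ Set.range X := by
  obtain ⟨-, i, hi⟩ := hτ
  exact hi.trans (Set.image_subset_range _ _)

theorem IsRep.label_coeff {c : Matrix (Fin 4) (Fin 4) ℝ →₀ ℝ} {x : Matrix (Fin 4) (Fin 4) ℝ}
    (h : IsRep T c x) : ∑ z, c (X z) = 1 ∧ ∑ z, c (X z) • X z = x := by
  classical
  have hsub : c.support ⊆ Finset.univ.image X := fun a ha => by
    simpa using subset_range_X h.support_mem ha
  rw [← h.sum_eq_one, ← h.sum_smul_eq,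
    Finset.sum_subset hsub fun a _ ha => Finsupp.notMem_support_iff.1 ha,
    Finset.sum_subset (f := fun a => c a • a) hsub fun a _ ha => by
      rw [Finsupp.notMem_support_iff.1 ha, zero_smul],
    Finset.sum_image X_injective.injOn, Finset.sum_image X_injective.injOn]
  exact ⟨rfl, rfl⟩

theorem T_down_closed : ∀ τ ∈ T, ∀ ρ ⊆ τ, ρ.Nonempty → ρ ∈ T :=
  fun _ ⟨_, i, hi⟩ _ hρ hne => ⟨hne, i, (Finset.coe_subset.2 hρ).trans hi⟩

theorem triangulates_T : Triangulates T F := by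
  classical
  refine ⟨fun τ hτ => hτ.1, T_down_closed, fun τ hτ => (subset_range_X hτ).trans
    (Set.range_subset_iff.2 X_mem_F), fun x hx => ?_, fun c c' x h h' => ?_⟩
  · rw [F_eq_convexHull, ← Set.image_univ, ← Finset.coe_univ, ← Finset.coe_image] at hx
    obtain ⟨u, hu, h1, hx⟩ := Finset.mem_convexHull'.1 hx
    rw [Finset.sum_image X_injective.injOn] at h1 hx
    obtain ⟨i, y, hnn, hsupp⟩ := exists_simplex_coeff (c := fun z => u (X z))
      fun z => hu _ (Finset.mem_image_of_mem X (Finset.mem_univ z))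
    set c : Label → ℝ := (fun z => u (X z)) - gale y with hc
    have hcX : ∀ z, Function.extend X c 0 (X z) = c z := X_injective.extend_apply c 0
    have h0 : ∀ a ∈ (simplex i).image X, 0 ≤ Function.extend X c 0 a := fun a ha => by
      obtain ⟨z, -, rfl⟩ := Finset.mem_image.1 ha
      rw [hcX]
      exact hnn z
    have h1' : ∑ a ∈ (simplex i).image X, Function.extend X c 0 a = 1 := by
      rw [Finset.sum_image X_injective.injOn]
      simp only [hcX]
      rw [Finset.sum_subset (Finset.subset_univ _) fun z _ hz => hsupp z hz]
      simp only [hc, Pi.sub_apply, Finset.sum_sub_distrib, h1, sum_gale, sub_zero]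
    have hx' : ∑ a ∈ (simplex i).image X, Function.extend X c 0 a • a = x := by
      rw [Finset.sum_image X_injective.injOn]
      simp only [hcX]
      rw [Finset.sum_subset (Finset.subset_univ _) fun z _ hz => by rw [hsupp z hz, zero_smul]]
      simp only [hc, Pi.sub_apply, sub_smul, Finset.sum_sub_distrib, hx, sum_gale_smul_X, sub_zero]
    obtain ⟨c', hc', -⟩ := exists_isRep_of_sum T_down_closed (image_simplex_mem_T i) h0 h1' hx'
    exact ⟨c', hc'⟩
  · obtain ⟨i, hi⟩ := h.support_mem.2
    obtain ⟨j, hj⟩ := h'.support_mem.2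
    have hout : ∀ {d : Matrix (Fin 4) (Fin 4) ℝ →₀ ℝ} {i : Fin 32},
        (d.support : Set (Matrix (Fin 4) (Fin 4) ℝ)) ⊆ X '' (simplex i : Set Label) →
        ∀ z ∉ simplex i, d (X z) = 0 := by
      intro d i hd z hz
      by_contra hne
      obtain ⟨z', hz', hzz⟩ := hd (Finsupp.mem_support_iff.2 hne)
      exact hz (X_injective hzz ▸ hz')
    obtain ⟨h1, hx⟩ := h.label_coeff
    obtain ⟨h1', hx'⟩ := h'.label_coeff
    obtain ⟨y, hy⟩ := exists_gale_eq (c := (fun z => c (X z)) - fun z => c' (X z))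
      (by simp only [Pi.sub_apply, Finset.sum_sub_distrib, h1, h1', sub_self])
      (by simp only [Pi.sub_apply, sub_smul, Finset.sum_sub_distrib, hx, hx', sub_self])
    have heq := coeff_unique (fun z => h.nonneg _) (fun z => h'.nonneg _) (hout hi) (hout hj) hy
    ext1 M
    by_cases hM : M ∈ Set.range X
    · obtain ⟨z, rfl⟩ := hM
      exact congrFun heq z
    · rw [Finsupp.notMem_support_iff.1 fun h' => hM (subset_range_X h.support_mem h'),
        Finsupp.notMem_support_iff.1 fun h => hM (subset_range_X h'.support_mem h)]

theorem isTriangulation_T : IsTriangulation (F.extremePoints ℝ) T := by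
  rw [extremePoints_F]
  exact Triangulates.isTriangulation (Set.finite_range X) (F_eq_convexHull ▸ triangulates_T)
    fun τ hτ => subset_range_X hτ

theorem X_mem_affineSpan_simplex (i : Fin 32) (q : Label) :
    X q ∈ affineSpan ℝ (X '' (simplex i : Set Label)) := by
  obtain ⟨y, hy⟩ := exists_gale_eq_on_compl i fun z => (Pi.single q 1 : Label → ℝ) z
  set c : Label → ℝ := Pi.single q 1 - gale y with hc
  have hsupp : ∀ z ∉ simplex i, c z = 0 := fun z hz => by
    rw [hc, Pi.sub_apply, hy ⟨z, hz⟩, sub_self]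
  have h1 : ∑ z ∈ simplex i, c z = 1 := by
    rw [Finset.sum_subset (Finset.subset_univ _) fun z _ hz => hsupp z hz]
    simp [hc, sum_gale]
  have hx : ∑ z ∈ simplex i, c z • X z = X q := by
    rw [Finset.sum_subset (Finset.subset_univ _) fun z _ hz => by rw [hsupp z hz, zero_smul]]
    simp [hc, sub_smul, sum_gale_smul_X, Pi.single_apply]
  rw [← hx, ← Finset.affineCombination_eq_linear_combination _ _ _ h1]
  exact affineCombination_mem_affineSpan_image h1 (fun _ _ h => absurd ‹_› h) X

theorem finrank_vectorSpan_F : Module.finrank ℝ (vectorSpan ℝ F) = 7 := by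
  classical
  have hind := triangulates_T.affineIndependent (image_simplex_mem_T 0)
  have hcard : Fintype.card ((simplex 0).image X) = 7 + 1 := by
    rw [Fintype.card_coe, Finset.card_image_of_injective _ X_injective, card_simplex]
  have h := hind.finrank_vectorSpan hcard
  have hrange : Set.range ((↑) : (simplex 0).image X → Matrix (Fin 4) (Fin 4) ℝ) =
      X '' (simplex 0 : Set Label) := by
    rw [← Finset.coe_image]
    exact Subtype.range_coe
  rw [hrange] at h
  rw [← h]
  have hspan : affineSpan ℝ F = affineSpan ℝ (X '' (simplex 0 : Set Label)) := by
    rw [F_eq_convexHull, affineSpan_convexHull]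
    exact le_antisymm (affineSpan_le.2 (Set.range_subset_iff.2 (X_mem_affineSpan_simplex 0)))
      (affineSpan_mono ℝ (Set.image_subset_range _ _))
  rw [← direction_affineSpan, hspan, direction_affineSpan]

/-! ### The cones of the Gale dual -/

theorem Y_mem_cone {i : Fin 32} {z : Label} (hz : z ∉ simplex i) : Y z ∈ cone i :=
  Submodule.subset_span ⟨z, hz, rfl⟩

theorem span_cone (i : Fin 32) : Submodule.span ℝ (cone i) = ⊤ := by
  have h := (linearIndependent_Y i).span_eq_top_of_card_eq_finrank' (by
    rw [card_compl_simplex, Module.finrank_fintype_fun_eq_card, Fintype.card_fin])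
  rw [eq_top_iff, ← h]
  refine Submodule.span_mono ?_
  rintro _ ⟨z, rfl⟩
  exact Y_mem_cone z.2

/-- The vector `b` is an inner normal of the facet of the cone `i` opposite to the generator
`Y z₀`. -/
def IsFacetNormal (i : Fin 32) (b : Fin 6 → ℝ) (z₀ : Label) : Prop :=
  z₀ ∉ simplex i ∧ 0 < gale b z₀ ∧ ∀ z ∉ simplex i, z ≠ z₀ → gale b z = 0

variable {i : Fin 32} {b : Fin 6 → ℝ} {z₀ : Label}

theorem IsFacetNormal.nonneg (h : IsFacetNormal i b z₀) {z : Label} (hz : z ∉ simplex i) :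
    0 ≤ gale b z := by
  rcases eq_or_ne z z₀ with rfl | hne
  exacts [h.2.1.le, (h.2.2 z hz hne).ge]

theorem IsFacetNormal.dotProduct_nonneg (h : IsFacetNormal i b z₀) {y : Fin 6 → ℝ}
    (hy : y ∈ cone i) : 0 ≤ b ⬝ᵥ y := by
  refine Submodule.span_induction (p := fun y _ => 0 ≤ b ⬝ᵥ y) ?_ ?_ ?_ ?_ hy
  · rintro _ ⟨z, hz, rfl⟩
    rw [dotProduct_comm]
    exact h.nonneg hz
  · simp
  · intro u v _ _ hu hv
    rw [dotProduct_add]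
    exact add_nonneg hu hv
  · intro r u _ hu
    have : b ⬝ᵥ (r • u) = (r : ℝ) * (b ⬝ᵥ u) := dotProduct_smul (r : ℝ) b u
    rw [this]
    exact mul_nonneg r.2 hu

theorem IsFacetNormal.isFacetInequality (h : IsFacetNormal i b z₀) :
    IsFacetInequality (cone i) b := by
  refine ⟨fun y hy => h.dotProduct_nonneg hy, ?_⟩
  set S := Submodule.span ℝ {y ∈ cone i | b ⬝ᵥ y = 0} with hS
  rw [span_cone, finrank_top, Module.finrank_fintype_fun_eq_card, Fintype.card_fin]
  have hlt : Module.finrank ℝ S < 6 := by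
    have hne : S ≠ ⊤ := by
      intro htop
      have hz : Y z₀ ∈ S := htop ▸ Submodule.mem_top
      have hle : S ≤ LinearMap.ker (dotProductBilin ℝ ℝ b) :=
        Submodule.span_le.2 fun y hy => hy.2
      have : b ⬝ᵥ Y z₀ = 0 := hle hz
      rw [dotProduct_comm] at this
      exact h.2.1.ne' this
    simpa using Submodule.finrank_lt hne
  have hge : 5 ≤ Module.finrank ℝ S := by
    let e : {z : {z // z ∉ simplex i} // z ≠ ⟨z₀, h.1⟩} → {z // z ∉ simplex i} := Subtype.val
    have hli := (linearIndependent_Y i).comp e Subtype.val_injective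
    have hcard : Fintype.card {z : {z // z ∉ simplex i} // z ≠ ⟨z₀, h.1⟩} = 5 := by
      rw [Fintype.card_subtype_compl, Fintype.card_subtype_eq, card_compl_simplex]
    rw [← hcard, ← finrank_span_eq_card hli]
    refine Submodule.finrank_mono (Submodule.span_mono ?_)
    rintro _ ⟨z, rfl⟩
    refine ⟨Y_mem_cone z.1.2, ?_⟩
    rw [dotProduct_comm]
    exact h.2.2 _ z.1.2 fun hz => z.2 (Subtype.ext hz)
  omega

/-- From a point of the relative interior of a set, one can move a little away from any other point
of the set. -/
theorem exists_mem_of_mem_intrinsicInterior {s : Set (Fin 6 → ℝ)} {y z : Fin 6 → ℝ}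
    (hy : y ∈ intrinsicInterior ℝ s) (hz : z ∈ s) : ∃ ε : ℝ, 0 < ε ∧ y + ε • (y - z) ∈ s := by
  obtain ⟨y', hy', rfl⟩ := mem_intrinsicInterior.1 hy
  have hmem : ∀ t : ℝ, (y' : Fin 6 → ℝ) + t • ((y' : Fin 6 → ℝ) - z) ∈ affineSpan ℝ s := fun t => by
    rw [add_comm]
    exact AffineSubspace.smul_vsub_vadd_mem _ t y'.2 (subset_affineSpan ℝ s hz) y'.2
  let γ : ℝ → affineSpan ℝ s := fun t => ⟨_, hmem t⟩
  have hγ : Continuous γ := by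
    refine Continuous.subtype_mk ?_ _
    fun_prop
  have hnhds : ∀ᶠ t in nhds (0 : ℝ), γ t ∈ interior ((↑) ⁻¹' s : Set (affineSpan ℝ s)) := by
    refine hγ.continuousAt.eventually (isOpen_interior.mem_nhds ?_)
    convert! hy'
    ext1
    simp [γ]
  obtain ⟨ε, hε, hpos⟩ := ((hnhds.filter_mono nhdsWithin_le_nhds).and
    (self_mem_nhdsWithin : Set.Ioi (0 : ℝ) ∈ nhdsWithin 0 (Set.Ioi 0))).exists
  exact ⟨ε, hpos, (interior_subset hε : γ ε ∈ ((↑) ⁻¹' s : Set (affineSpan ℝ s)))⟩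

theorem IsFacetNormal.dotProduct_pos (h : IsFacetNormal i b z₀) {y : Fin 6 → ℝ}
    (hy : y ∈ intrinsicInterior ℝ (cone i)) : 0 < b ⬝ᵥ y := by
  refine (h.dotProduct_nonneg (intrinsicInterior_subset hy)).lt_of_ne fun h0 => ?_
  obtain ⟨ε, hε, hmem⟩ := exists_mem_of_mem_intrinsicInterior hy (Y_mem_cone h.1)
  have h1 := h.dotProduct_nonneg hmem
  have h2 : 0 < b ⬝ᵥ Y z₀ := by
    rw [dotProduct_comm]
    exact h.2.1
  rw [dotProduct_add, dotProduct_smul, dotProduct_sub, ← h0, smul_eq_mul] at h1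
  nlinarith [mul_pos hε h2]

theorem isFacetNormals :
    IsFacetNormal 0 ![0, 0, 1, 0, 0, 0] .k ∧ IsFacetNormal 9 ![0, -1, 0, 0, -1, 1] .n ∧
      IsFacetNormal 12 ![0, 0, 0, -1, 1, 0] .a ∧ IsFacetNormal 31 ![0, 1, -1, 1, 0, -1] .l := by
  refine ⟨⟨by decide, ?_, ?_⟩, ⟨by decide, ?_, ?_⟩, ⟨by decide, ?_, ?_⟩, ⟨by decide, ?_, ?_⟩⟩
  any_goals simp [gale_apply, Y, dotProduct, Fin.sum_univ_succ]; done
  all_goals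
    intro z hz hne
    cases z <;> first
      | exact absurd (by decide) hz
      | exact absurd rfl hne
      | simp [gale_apply, Y, dotProduct, Fin.sum_univ_succ]

/-- The four normals add up to zero. -/
theorem sum_normals (y : Fin 6 → ℝ) :
    ![0, 0, 1, 0, 0, 0] ⬝ᵥ y + ![0, -1, 0, 0, -1, 1] ⬝ᵥ y + ![0, 0, 0, -1, 1, 0] ⬝ᵥ y +
      ![0, 1, -1, 1, 0, -1] ⬝ᵥ y = 0 := by
  simp [dotProduct, Fin.sum_univ_succ]
  ring

theorem not_exists_pos : ¬ ∃ y : Fin 6 → ℝ, 0 < ![0, 0, 1, 0, 0, 0] ⬝ᵥ y ∧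
    0 < ![0, -1, 0, 0, -1, 1] ⬝ᵥ y ∧ 0 < ![0, 0, 0, -1, 1, 0] ⬝ᵥ y ∧
    0 < ![0, 1, -1, 1, 0, -1] ⬝ᵥ y := by
  rintro ⟨y, h1, h2, h3, h4⟩
  linarith [sum_normals y]

theorem iInter_intrinsicInterior_cone : (⋂ i, intrinsicInterior ℝ (cone i)) = ∅ := by
  refine Set.eq_empty_of_forall_notMem fun y hy => not_exists_pos ⟨y, ?_⟩
  rw [Set.mem_iInter] at hy
  exact ⟨isFacetNormals.1.dotProduct_pos (hy 0), isFacetNormals.2.1.dotProduct_pos (hy 9),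
    isFacetNormals.2.2.1.dotProduct_pos (hy 12), isFacetNormals.2.2.2.dotProduct_pos (hy 31)⟩

/-! ### Non-regularity -/

/-- If an affine function touches a lifting `w` from below exactly at the vertices of the simplex
`i`, then the image of `w` in the Gale dual satisfies the facet inequalities of the cone `i`
strictly. -/
theorem IsFacetNormal.dotProduct_lifting_pos (h : IsFacetNormal i b z₀) {w : Label → ℝ}
    {φ : Matrix (Fin 4) (Fin 4) ℝ →ₗ[ℝ] ℝ} {d : ℝ} (hle : ∀ z, d ≤ φ (X z) + w z)
    (heq : ∀ z, φ (X z) + w z = d ↔ z ∈ simplex i) : 0 < b ⬝ᵥ ∑ z, w z • Y z := by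
  have h1 : b ⬝ᵥ ∑ z, w z • Y z = ∑ z, w z * gale b z := by
    rw [dotProduct_sum]
    refine Finset.sum_congr rfl fun z _ => ?_
    rw [dotProduct_smul, smul_eq_mul, dotProduct_comm, gale_apply]
  have h2 : ∑ z, φ (X z) * gale b z = 0 := by
    have := congrArg φ (sum_gale_smul_X b)
    simpa [mul_comm] using this
  have h3 : ∑ z, w z * gale b z = ∑ z, (φ (X z) + w z - d) * gale b z := by
    simp only [sub_mul, add_mul, Finset.sum_sub_distrib, Finset.sum_add_distrib, h2,
      ← Finset.mul_sum, sum_gale]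
    ring
  rw [h1, h3]
  refine Finset.sum_pos' (fun z _ => ?_) ⟨z₀, Finset.mem_univ _, mul_pos ?_ h.2.1⟩
  · by_cases hz : z ∈ simplex i
    · rw [(heq z).2 hz, sub_self, zero_mul]
    · exact mul_nonneg (sub_nonneg.2 (hle z)) (h.nonneg hz)
  · exact sub_pos.2 ((hle z₀).lt_of_ne' fun h' => h.1 ((heq z₀).1 h'))

/-- A triangulation of points in convex position is not regular if it contains `T`. -/
theorem not_isRegularTriangulation {A : Set (Matrix (Fin 4) (Fin 4) ℝ)}
    {T' : Set (Finset (Matrix (Fin 4) (Fin 4) ℝ))} (hA : ∀ a ∈ A, a ∉ convexHull ℝ (A \ {a}))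
    (hTA : ∀ τ ∈ T', (τ : Set (Matrix (Fin 4) (Fin 4) ℝ)) ⊆ A) (hX : ∀ z, X z ∈ A) (hT : T ⊆ T') :
    ¬ IsRegularTriangulation A T' := by
  classical
  intro h
  obtain ⟨w, hw⟩ := h.exists_lifting hA hTA
  have key : ∀ {i b z₀}, IsFacetNormal i b z₀ → 0 < b ⬝ᵥ ∑ z, w (X z) • Y z := by
    intro i b z₀ hi
    obtain ⟨φ, d, hφ⟩ := hw _ (hT (image_simplex_mem_T i))
    refine hi.dotProduct_lifting_pos (fun z => (hφ _ (hX z)).1) fun z => (hφ _ (hX z)).2.trans ?_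
    rw [Finset.mem_image]
    exact ⟨fun ⟨z', hz', hzz⟩ => X_injective hzz ▸ hz', fun hz => ⟨z, hz, rfl⟩⟩
  exact not_exists_pos ⟨_, key isFacetNormals.1, key isFacetNormals.2.1,
    key isFacetNormals.2.2.1, key isFacetNormals.2.2.2⟩

/-! ### Extending the triangulation to the Birkhoff polytope -/

/-- Placing, as well as pulling, the vertices of the Birkhoff polytope outside `F` extends `T` to a
triangulation. It is not regular, because a lifting that induced it would induce `T` on `F`. -/
theorem isTriangulation_extension {l : List (Matrix (Fin 4) (Fin 4) ℝ)} (hl : l.Nodup)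
    (hmem : ∀ M, M ∈ l ↔ M ∈ B₄.extremePoints ℝ ∧ M ∉ F)
    {T' : Set (Finset (Matrix (Fin 4) (Fin 4) ℝ))} (hT' : T' = placing T l ∨ T' = pulling T l B₄) :
    IsTriangulation (B₄.extremePoints ℝ) T' ∧ {τ ∈ T' | (τ : Set _) ⊆ F} = T ∧
      ¬ IsRegularTriangulation (B₄.extremePoints ℝ) T' := by
  have hlF : ∀ v ∈ l, v ∉ F := fun v hv => ((hmem v).1 hv).2
  have hlV : ∀ v ∈ l, v ∈ B₄.extremePoints ℝ := fun v hv => ((hmem v).1 hv).1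
  have hXV : Set.range X ⊆ B₄.extremePoints ℝ := Set.range_subset_iff.2 X_mem_extremePoints_B₄
  have hTF : ∀ τ ∈ T, (τ : Set (Matrix (Fin 4) (Fin 4) ℝ)) ⊆ F := triangulates_T.subset
  have hTV : ∀ τ ∈ T, (τ : Set (Matrix (Fin 4) (Fin 4) ℝ)) ⊆ B₄.extremePoints ℝ :=
    fun τ hτ => (subset_range_X hτ).trans hXV
  have hext := notMem_convexHull_of_extremePoints convex_B₄
  have hVF : ∀ v ∈ B₄.extremePoints ℝ, v ∈ F → v ∈ Set.range X := fun v hv hF => by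
    rw [← extremePoints_F, isExposed_F.isExtreme.extremePoints_eq]
    exact ⟨hF, hv⟩
  suffices h : Triangulates T' (convexHull ℝ (B₄.extremePoints ℝ)) ∧
      (∀ τ ∈ T', (τ : Set (Matrix (Fin 4) (Fin 4) ℝ)) ⊆ B₄.extremePoints ℝ) ∧
      {τ ∈ T' | (τ : Set _) ⊆ F} = T by
    obtain ⟨h1, h2, h3⟩ := h
    refine ⟨h1.isTriangulation finite_extremePoints_B₄ h2, h3,
      not_isRegularTriangulation hext h2 X_mem_extremePoints_B₄ ?_⟩
    rw [← h3]
    exact fun τ hτ => hτ.1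
  rcases hT' with rfl | rfl
  · refine ⟨?_, mem_of_mem_placing hTV hlV, ?_⟩
    · have h := Triangulates.placing finite_extremePoints_B₄ hext l hl hlV hXV
        (fun v hv hvX => hlF v hv (by obtain ⟨z, rfl⟩ := hvX; exact X_mem_F z))
        (F_eq_convexHull ▸ triangulates_T)
      have hset : B₄.extremePoints ℝ = Set.range X ∪ {v | v ∈ l} := by
        ext v
        refine ⟨fun hv => ?_, fun hv => hv.elim (fun h => hXV h) (hlV v)⟩
        by_cases hF : v ∈ F
        · exact Or.inl (hVF v hv hF)
        · exact Or.inr ((hmem v).2 ⟨hv, hF⟩)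
      rwa [hset]
    · rw [placing_inter hlF]
      exact Set.sep_eq_self_iff_mem_true.2 hTF
  · refine ⟨?_, mem_of_mem_pulling hTV hlV, ?_⟩
    · have h := Triangulates.pulling finite_extremePoints_B₄ triangulates_T convex_F
        (B₄_eq_convexHull ▸ isExposed_F.subset) l fun v hv => by
          by_cases hF : v ∈ F
          · exact Or.inr hF
          · exact Or.inl ((hmem v).2 ⟨hv, hF⟩)
      rwa [← B₄_eq_convexHull] at h ⊢
    · exact Set.Subset.antisymm (fun τ hτ => mem_of_mem_pulling_of_subset hlF τ hτ.1 hτ.2)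
        fun τ hτ => ⟨mem_pulling_of_mem isExposed_F hlF Set.Subset.rfl hτ (hTF τ hτ)
          ((hTF τ hτ).trans isExposed_F.subset), hTF τ hτ⟩

theorem exists_order : ∃ l : List (Matrix (Fin 4) (Fin 4) ℝ), l.Nodup ∧
    ∀ M, M ∈ l ↔ M ∈ B₄.extremePoints ℝ ∧ M ∉ F := by
  classical
  have hfin : (B₄.extremePoints ℝ \ F).Finite := finite_extremePoints_B₄.sdiff
  exact ⟨hfin.toFinset.toList, Finset.nodup_toList _, fun M => by simp⟩

end BirkhoffFour

open BirkhoffFour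
theorem mainTheorem5 :
    -- `F` is a 7-dimensional face of the Birkhoff polytope, with the 14 vertices `X_a, …, X_n`
    (IsExposed ℝ B₄ F ∧ Module.finrank ℝ (vectorSpan ℝ F) = 7 ∧
      Function.Injective X ∧ F.extremePoints ℝ = Set.range X) ∧
    -- the 32 seven-dimensional simplices triangulate `F`
    ((∀ i, (simplex i).card = 8) ∧ Function.Injective simplex ∧
      IsTriangulation (F.extremePoints ℝ) T) ∧
    -- in the Gale dual, the 32 complementary cones are simple and full-dimensional
    (IsGaleTransform homogenization Y ∧
      (∀ i, LinearIndependent ℝ (fun z : {z // z ∉ simplex i} => Y z) ∧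
        Submodule.span ℝ (cone i) = ⊤)) ∧
    -- four facet inequalities of the cones `C_1`, `C_10`, `C_13`, `C_32` are inconsistent
    (IsFacetInequality (cone 0) ![0, 0, 1, 0, 0, 0] ∧
      IsFacetInequality (cone 9) ![0, -1, 0, 0, -1, 1] ∧
      IsFacetInequality (cone 12) ![0, 0, 0, -1, 1, 0] ∧
      IsFacetInequality (cone 31) ![0, 1, -1, 1, 0, -1] ∧
      (¬ ∃ y : Fin 6 → ℝ, 0 < ![0, 0, 1, 0, 0, 0] ⬝ᵥ y ∧ 0 < ![0, -1, 0, 0, -1, 1] ⬝ᵥ y ∧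
        0 < ![0, 0, 0, -1, 1, 0] ⬝ᵥ y ∧ 0 < ![0, 1, -1, 1, 0, -1] ⬝ᵥ y) ∧
      (⋂ i, intrinsicInterior ℝ (cone i)) = ∅) ∧
    -- the triangulation of `F` is non-regular
    ¬ IsRegularTriangulation (F.extremePoints ℝ) T ∧
    -- placing, as well as pulling, the vertices outside `F` in any order extends it to a
    -- non-regular triangulation of the Birkhoff polytope
    (∀ l : List (Matrix (Fin 4) (Fin 4) ℝ), l.Nodup →
      (∀ M, M ∈ l ↔ M ∈ B₄.extremePoints ℝ ∧ M ∉ F) →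
      ∀ T', T' = placing T l ∨ T' = pulling T l B₄ →
        IsTriangulation (B₄.extremePoints ℝ) T' ∧ {τ ∈ T' | (τ : Set _) ⊆ F} = T ∧
          ¬ IsRegularTriangulation (B₄.extremePoints ℝ) T') ∧
    -- in particular, the Birkhoff polytope has a non-regular triangulation extending `T`
    (∃ T', IsTriangulation (B₄.extremePoints ℝ) T' ∧ {τ ∈ T' | (τ : Set _) ⊆ F} = T ∧
      ¬ IsRegularTriangulation (B₄.extremePoints ℝ) T') := by
  obtain ⟨h1, h2, h3, h4⟩ := isFacetNormals
  refine ⟨⟨isExposed_F, finrank_vectorSpan_F, X_injective, extremePoints_F⟩,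
    ⟨card_simplex, simplex_injective, isTriangulation_T⟩,
    ⟨isGaleTransform_Y, fun i => ⟨linearIndependent_Y i, span_cone i⟩⟩,
    ⟨h1.isFacetInequality, h2.isFacetInequality, h3.isFacetInequality, h4.isFacetInequality,
      not_exists_pos, iInter_intrinsicInterior_cone⟩, ?_,
    fun l hl hmem T' hT' => isTriangulation_extension hl hmem hT', ?_⟩
  · exact not_isRegularTriangulation (notMem_convexHull_of_extremePoints convex_F)
      (fun τ hτ => extremePoints_F ▸ subset_range_X hτ)
      (fun z => extremePoints_F ▸ Set.mem_range_self z) Set.Subset.rfl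
  · obtain ⟨l, hl, hmem⟩ := exists_order
    exact ⟨_, isTriangulation_extension hl hmem (Or.inl rfl)⟩
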